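/- Theorem 2 (Coordinate Descent). Setting. There are $m\ge 1$ workers and a master, a data matrix $X\in\mathbb R^{n\times d}$ with rows $x_1,\dots,x_n$, labels $y\in\mathbb R^n$, $m\le n$ and $m\le d$, and the objective $\phi(Xw;y)=\sum_{i=1}^n\ell(\langle x_i,w\rangle;y_i)$, where $\ell(\cdot\,;b)$ is differentiable for every $b$; $\phi'(Xw;y)\in\mathbb R^n$ has entries $\ell'(\langle x_i,w\rangle;y_i)$. In every round of communication at most $t$ workers are corrupt and may send arbitrary answers, and the answers of at most $s$ workers (stragglers) may be missing; these sets may change from round to round and are not revealed to the master, except that missing answers are seen to be missing; the memory of a worker is not tampered with. For $\epsilon>0$ put $r=\left\lfloor\frac{\epsilon}{1+\epsilon}\cdot\frac m2\right\rfloor$, $q=m-2r$, $p_1=\lceil n/q\rceil$, $p_2=\lceil d/q\rceil$. Then $\frac m{1+\epsilon}\le q<\frac m{1+\epsilon}+2$. For an $m\times q$ matrix $B$ and $N\ge1$, let $\mathrm{Enc}_N(B)$ be the matrix with $N$ columns and one block of $\lceil N/q\rceil$ rows for each worker $i$, in which row $a$ of block $i$ carries the $i$-th row of $B$ in the columns $(a-1)q+1,\dots,\min(aq,N)$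 and is zero elsewhere. For $a\in[p_2]$ let $f(a)=\{(a-1)q+1,\dots,\min(aq,d)\}$, and $f(U)=\bigcup_{a\in U}f(a)$ for $U\subseteq[p_2]$. Claim. There is an absolute constant $C$ such that for all such $m,n,d,\epsilon$ there are $m\times q$ matrices $B_L,B_R$, where $B_R$ has orthonormal columns, and programs for encoding, for the workers and for the master, none of which depends on the data, labels, loss, parameters or step sizes, with the following properties. Put $L=\mathrm{Enc}_n(B_L)$ (blocks $L_i$), $S=\mathrm{Enc}_d(B_R)$ and $R=S^T=[R_1\ \cdots\ R_m]$. Then $S^TS=I$ and $S=R^+:=R^T(RR^T)^{-1}$, $RR^+=I$; worker $i$ stores $L_iX$, $XR_i$ and its part $v_i\in\mathbb R^{p_2}$ of the encoded parameter $v$. The algorithm starts from any $w^0\in\mathbb R^d$ and $v^0=R^+w^0$ and uses any step sizes $\alpha_k$ and sets $U_k\subseteq[p_2]$. In iteration $k$ the master broadcasts the change $w^{k-1}-w^k$ on $f(U_{k-1})$ (for $k=0$: the vector $-w^0$); every worker answers with $p_1$ numbers; the master broadcasts a vector in $\mathbb R^n$; every worker $i$ updates the coordinates of $v_i$ in $U_k$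 and sends them to the master; the master computes $w^{k+1}$ on $f(U_k)$ and keeps the other coordinates of $w^k$. Resilience: whenever $s+t\le r=\left\lfloor\frac{\epsilon}{1+\epsilon}\cdot\frac m2\right\rfloor$, against every adversary as above and for all $k$: the broadcast vector is $\phi'(Xw^k;y)$; $w^{k+1}$ is exactly the result of one step of plain coordinate descent, with step size $\alpha_k$, on the coordinates $f(U_k)$ of $w^k$ for $w\mapsto\phi(Xw;y)$; $v^{k+1}$ is the result of one such step from $v^k$, on the coordinates in $U_k$ of all the $v_i$, for $v\mapsto\phi(XRv;y)$; and $v^k=R^+w^k$. Costs (unit cost for an arithmetic operation on reals, an evaluation of $\ell'$ and a test for zero; worst case over all inputs; the programs are algebraic computation trees, may depend on $m,n,d,\epsilon$ and on the sets $U_k$, and hold real constants such as the entries of $B_L,B_R$). "Exact case" means $q=\frac m{1+\epsilon}$, i.e. no rounding. - The total storage at the workers is at most $2(1+\epsilon)nd+(1+\epsilon)d+m(n+d+1)$ real numbers, and exactly $2(1+\epsilon)nd+(1+\epsilon)d$ in the exact case if $q$ divides $n$ and $d$. - If every worker updates $\tau$ coordinates of its $v_i$, i.e. $|U|=\tau$,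 then $\tau q-q<|f(U)|\le\tau q$; if all chunks $f(a)$, $a\in U$, have full length $q$, then $|f(U)|=\tau q$, which is $\frac{\tau m}{1+\epsilon}$ in the exact case. - In an iteration with $|U_k|=\tau$ each worker sends $\tau+p_1\le\tau+\left\lceil(1+\epsilon)\frac nm\right\rceil$ real numbers (exactly $\tau+(1+\epsilon)\frac nm$ in the exact case if $q\mid n$). If also $|U_{k-1}|=\tau$, the master broadcasts $|f(U_{k-1})|+n\le\tau\left(\frac m{1+\epsilon}+2\right)+n$ real numbers (at most $\frac{\tau m}{1+\epsilon}+n$ in the exact case). - In such an iteration each worker computes for at most $Cn\tau$ time (in the very first iteration at most $C\left(n\tau+(1+\epsilon)\frac{nd}m\right)$), and the master for at most $C\left((1+\epsilon)nm+\tau m^2\right)$ time. - The encoding of the data (computing all $L_iX$ and $XR_i$ from $X$) takes at most $C\,nd\left(\frac{\epsilon}{1+\epsilon}m+1\right)$ time. -/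

import Mathlib

open Matrix

/-! ### Cost model: algebraic computation trees over the reals

Every basic arithmetic operation on real numbers, every evaluation of the scalar derivative
`ℓ'(u; y)` of the loss and every zero test takes one unit of time. Reading an input, a constant
of the program or a register is free. -/

/-- The operations that take unit time. -/
inductive RealOp where
  | add
  | sub
  | mul
  | div
  | lossDeriv

/-- The value of an operation; `dl u y` stands for `ℓ'(u; y)`. A program that wants to avoid
dividing by zero can test the divisor first. -/
noncomputable def RealOp.value (dl : ℝ → ℝ → ℝ) : RealOp → ℝ → ℝ → ℝ
  | .add, a, b => a + b
  | .sub, a, b => a - b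
  | .mul, a, b => a * b
  | .div, a, b => a / b
  | .lossDeriv, a, b => dl a b

/-- What an operation can refer to: an input, a constant, or a register. -/
inductive Operand (ι : Type) where
  | input (i : ι)
  | const (c : ℝ)
  | reg (k : ℕ)

/-- The value of an operand, for the input `x` and the register contents `ρ`. -/
def Operand.value {ι : Type} (x : ι → ℝ) (ρ : ℕ → ℝ) : Operand ι → ℝ
  | .input i => x i
  | .const c => c
  | .reg k => ρ k

/-- An algebraic computation tree with real inputs indexed by `ι` and real outputs indexed
by `κ`. -/
inductive Prog (ι κ : Type) where
  /-- stop, and output the listed operands -/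
  | ret (out : κ → Operand ι)
  /-- write the result of an operation to the register `dst`, and go on -/
  | op (dst : ℕ) (o : RealOp) (a b : Operand ι) (next : Prog ι κ)
  /-- test whether `a` is zero, and branch -/
  | ifZero (a : Operand ι) (yes no : Prog ι κ)

/-- The output of a program on input `x`, started with register contents `ρ`. -/
noncomputable def Prog.evalFrom {ι κ : Type} (dl : ℝ → ℝ → ℝ) (x : ι → ℝ) :
    Prog ι κ → (ℕ → ℝ) → κ → ℝ
  | .ret out, ρ => fun k => (out k).value x ρ
  | .op dst o a b next, ρ =>
      next.evalFrom dl x (Function.update ρ dst (o.value dl (a.value x ρ) (b.value x ρ)))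
  | .ifZero a yes no, ρ =>
      open Classical in
      if a.value x ρ = 0 then yes.evalFrom dl x ρ else no.evalFrom dl x ρ

/-- The output of a program on input `x`; all registers are zero at the start. -/
noncomputable def Prog.eval {ι κ : Type} (dl : ℝ → ℝ → ℝ) (P : Prog ι κ) (x : ι → ℝ) : κ → ℝ :=
  P.evalFrom dl x 0

/-- The worst-case running time of a program: the depth of the tree. -/
def Prog.time {ι κ : Type} : Prog ι κ → ℕ
  | .ret _ => 0
  | .op _ _ _ _ next => next.time + 1
  | .ifZero _ yes no => max yes.time no.time + 1

/-! ### The learning problem and plain coordinate descent -/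

/-- The objective `φ(Xw; y) = ∑ i, ℓ(⟨x_i, w⟩; y_i)` of a generalized linear model, as a
function of `w`; the rows of `X` are the data points `x_i`. -/
noncomputable def glmObjective {n : ℕ} {κ : Type} [Fintype κ] (ℓ : ℝ → ℝ → ℝ)
    (X : Matrix (Fin n) κ ℝ) (y : Fin n → ℝ) (w : κ → ℝ) : ℝ :=
  ∑ i, ℓ ((X *ᵥ w) i) (y i)

/-- The scalar derivative `ℓ'(u; y) = ∂ℓ(u; y)/∂u`. -/
noncomputable def scalarDeriv (ℓ : ℝ → ℝ → ℝ) (u y : ℝ) : ℝ :=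
  deriv (fun x => ℓ x y) u

/-- One step of plain coordinate descent with step size `α` on the coordinates in `F`: these
move along the negative partial derivatives of the objective, the others stay. -/
noncomputable def cdStep {n : ℕ} {κ : Type} [Fintype κ] [DecidableEq κ] (ℓ : ℝ → ℝ → ℝ)
    (X : Matrix (Fin n) κ ℝ) (y : Fin n → ℝ) (α : ℝ) (F : Finset κ) (w : κ → ℝ) : κ → ℝ :=
  fun j => if j ∈ F then
      w j - α * lineDeriv ℝ (glmObjective ℓ X y) w (Pi.single j 1)
    else w j

/-! ### Block-structured encoding matrices -/

/-- The resilience threshold `⌊(ε/(1+ε)) · m/2⌋`. -/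
noncomputable def cdThreshold (m : ℕ) (ε : ℝ) : ℕ := ⌊ε / (1 + ε) * ((m : ℝ) / 2)⌋₊

/-- The block size `q = m - 2r`, where `r` is the resilience threshold. -/
noncomputable def blockSize (m : ℕ) (ε : ℝ) : ℕ := m - 2 * cdThreshold m ε

/-- The number `⌈N/q⌉` of blocks of length at most `q` into which `N` coordinates are cut. -/
def numBlocks (N q : ℕ) : ℕ := (N + q - 1) / q

/-- The `m · ⌈N/q⌉ × N` encoding matrix made from an `m × q` matrix `B` with columns
`b_1, …, b_q`. The block of worker `i` has `⌈N/q⌉` rows; row `a` of it carries the row `i` of `B`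
in the columns of the `a`-th chunk of `q` coordinates and is zero elsewhere; in the last row, the
row of `B` is cut off at the last column. -/
def blockEncoding {m q : ℕ} (N : ℕ) (B : Matrix (Fin m) (Fin q) ℝ) :
    Matrix (Fin m × Fin (numBlocks N q)) (Fin N) ℝ :=
  fun ia j =>
    if h : (ia.2 : ℕ) * q ≤ (j : ℕ) ∧ (j : ℕ) - (ia.2 : ℕ) * q < q then
      B ia.1 ⟨(j : ℕ) - (ia.2 : ℕ) * q, h.2⟩
    else 0

/-- The set `f(U)` of the coordinates that lie in the chunks with index in `U`. -/
def chunkCoords {N q : ℕ} (U : Finset (Fin (numBlocks N q))) : Finset (Fin N) :=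
  Finset.univ.filter fun j => ∃ a ∈ U, (a : ℕ) * q ≤ (j : ℕ) ∧ (j : ℕ) < ((a : ℕ) + 1) * q

/-- The Moore-Penrose inverse `R⁺ = Rᵀ (R Rᵀ)⁻¹` of a matrix of full row rank. -/
noncomputable def rightPinv {κ μ : Type} [Fintype κ] [Fintype μ] [DecidableEq κ]
    (R : Matrix κ μ ℝ) : Matrix μ κ ℝ :=
  Rᵀ * (R * Rᵀ)⁻¹

/-! ### Memories and messages: index sets of real numbers -/

/-- The encoded data of one worker `i`: the `⌈n/q⌉ × d` matrix `L_i X` and the `n × ⌈d/q⌉`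
matrix `X R_i`. -/
abbrev EncodedData (n d q : ℕ) : Type :=
  (Fin (numBlocks n q) × Fin d) ⊕ (Fin n × Fin (numBlocks d q))

/-- The memory of one worker: its encoded data and its part `v_i` of the encoded parameters. -/
abbrev WorkerMemory (n d q : ℕ) : Type := EncodedData n d q ⊕ Fin (numBlocks d q)

/-- The memory of the master: the parameter `w`, the last product `X w` that it knows, and the
labels `y`. -/
abbrev MasterMemory (n d : ℕ) : Type := Fin d ⊕ (Fin n ⊕ Fin n)

/-- The first broadcast: the change of `w` on `f(U')`, where `U'` was used in the previous
iteration. -/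
abbrev Broadcast₁ {d q : ℕ} (U' : Finset (Fin (numBlocks d q))) : Type :=
  ↥(chunkCoords (N := d) U')

/-- The second broadcast: the vector `φ'(Xw; y)`. -/
abbrev Broadcast₂ (n : ℕ) : Type := Fin n

/-- The first answer of a worker. -/
abbrev Answer₁ (n q : ℕ) : Type := Fin (numBlocks n q)

/-- The second answer of a worker: the updated coordinates of its `v_i`. -/
abbrev Answer₂ {d q : ℕ} (U : Finset (Fin (numBlocks d q))) : Type := ↥U

/-- How many real numbers a worker sends in an iteration that updates the coordinates in `U`. -/
def realsSentByWorker (n : ℕ) {d q : ℕ} (U : Finset (Fin (numBlocks d q))) : ℕ :=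
  Fintype.card (Answer₁ n q) + Fintype.card (Answer₂ U)

/-- How many real numbers the master broadcasts in an iteration whose predecessor updated the
coordinates in `U'`. -/
def realsBroadcast (n : ℕ) {d q : ℕ} (U' : Finset (Fin (numBlocks d q))) : ℕ :=
  Fintype.card (Broadcast₁ U') + Fintype.card (Broadcast₂ n)

/-- How many real numbers all the `m` workers together store. -/
def totalStorage (m n d q : ℕ) : ℕ := Fintype.card (Fin m × WorkerMemory n d q)

/-! ### Encoded distributed coordinate descent -/

/-- A scheme for distributed coordinate descent with `m` workers, `n` data points and `d`
coordinates: the two matrices that define the encodings, and the programs that encode the data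
and are run by the workers and by the master. None of it depends on the data, the labels, the
loss, the parameters or the step sizes. -/
structure CDScheme (m n d q : ℕ) where
  /-- the matrix that defines the left encoding `L` -/
  BL : Matrix (Fin m) (Fin q) ℝ
  /-- the matrix that defines the right encoding `R = Sᵀ` -/
  BR : Matrix (Fin m) (Fin q) ℝ
  /-- computes the encoded data of all workers from the data matrix -/
  encode : Prog (Fin n × Fin d) (Fin m × EncodedData n d q)
  /-- first answer of a worker, computed from its memory and the first broadcast -/
  worker₁ : Fin m → (U' : Finset (Fin (numBlocks d q))) →
    Prog (WorkerMemory n d q ⊕ Broadcast₁ U') (Answer₁ n q)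
  /-- from the master's memory and the first answers: the products `X w`, and the second
  broadcast -/
  master₁ : Prog (MasterMemory n d ⊕ (Fin m × Answer₁ n q)) (Fin n ⊕ Broadcast₂ n)
  /-- the updated coordinates of `v_i`, computed by a worker from its memory, the second broadcast
  and the step size -/
  worker₂ : Fin m → (U : Finset (Fin (numBlocks d q))) →
    Prog (WorkerMemory n d q ⊕ (Broadcast₂ n ⊕ Unit)) (Answer₂ U)
  /-- from the master's memory and the second answers: the updated coordinates of `w`, and the
  first broadcast of the next iteration -/
  master₂ : (U : Finset (Fin (numBlocks d q))) →
    Prog (MasterMemory n d ⊕ (Fin m × Answer₂ U)) (↥(chunkCoords (N := d) U) ⊕ Broadcast₁ U)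

namespace CDScheme

variable {m n d q : ℕ}

/-- The left encoding matrix `L`, with one block of `⌈n/q⌉` rows for each worker. -/
def L (P : CDScheme m n d q) : Matrix (Fin m × Fin (numBlocks n q)) (Fin n) ℝ :=
  blockEncoding n P.BL

/-- The structured sparse matrix `S`, with one block of `⌈d/q⌉` rows for each worker. -/
def S (P : CDScheme m n d q) : Matrix (Fin m × Fin (numBlocks d q)) (Fin d) ℝ :=
  blockEncoding d P.BR

/-- The right encoding matrix `R = Sᵀ`, with one block of `⌈d/q⌉` columns for each worker. -/
def R (P : CDScheme m n d q) : Matrix (Fin d) (Fin m × Fin (numBlocks d q)) ℝ := P.Sᵀ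

/-- The encoded data `(L_i X, X R_i)` of worker `i`. -/
def encodedData (P : CDScheme m n d q) (X : Matrix (Fin n) (Fin d) ℝ) (i : Fin m) :
    EncodedData n d q → ℝ :=
  Sum.elim (fun aj => (P.L * X) (i, aj.1) aj.2) (fun ka => (X * P.R) ka.1 (i, ka.2))

/-- The memory contents of worker `i` when the encoded parameter vector is `v`. -/
def workerMemory (P : CDScheme m n d q) (X : Matrix (Fin n) (Fin d) ℝ)
    (v : Fin m × Fin (numBlocks d q) → ℝ) (i : Fin m) : WorkerMemory n d q → ℝ :=
  Sum.elim (P.encodedData X i) (fun a => v (i, a))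

end CDScheme

/-- The memory contents of the master. -/
def masterMemory {n d : ℕ} (w : Fin d → ℝ) (u y : Fin n → ℝ) : MasterMemory n d → ℝ :=
  Sum.elim w (Sum.elim u y)

/-- Delivery of the workers' answers in one round: at most `s` of them are missing because of
stragglers, at most `t` of them come from corrupt workers and are arbitrary, and all others
arrive as they were computed. -/
def Delivered {m : ℕ} {κ : Type} (s t : ℕ) (sent : Fin m → κ → ℝ)
    (recv : Fin m → Option (κ → ℝ)) : Prop :=
  ∃ stragglers corrupt : Finset (Fin m), stragglers.card ≤ s ∧ corrupt.card ≤ t ∧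
    (∀ i ∈ stragglers, recv i = none) ∧
    ∀ i, i ∉ stragglers → i ∉ corrupt → recv i = some (sent i)

/-- What the master reads after a round; missing answers are read as zero. -/
def readAnswers {m : ℕ} {κ : Type} (recv : Fin m → Option (κ → ℝ)) : Fin m × κ → ℝ :=
  fun ik => (recv ik.1).getD 0 ik.2

/-- The set of coordinates that the iteration before `k` updated. Before the first iteration the
whole parameter vector is regarded as new. -/
def previousChoice {p : ℕ} (U : ℕ → Finset (Fin p)) : ℕ → Finset (Fin p)
  | 0 => Finset.univ
  | k + 1 => U k

/-- An execution of the scheme `P` on the data `X`, `y`, for the loss with derivative `dl`, the step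
sizes `α`, the choices `U` of coordinates of the `v_i`, and the starting point `w0`, against an
adversary who in every round may corrupt at most `t` answers and delay at most `s`. A tampered
answer does not affect the worker's own memory. -/
structure CDExecution {m n d q : ℕ} (P : CDScheme m n d q) (dl : ℝ → ℝ → ℝ)
    (X : Matrix (Fin n) (Fin d) ℝ) (y : Fin n → ℝ) (α : ℕ → ℝ)
    (U : ℕ → Finset (Fin (numBlocks d q))) (w0 : Fin d → ℝ) (s t : ℕ) where
  /-- the parameter vector at the master -/
  w : ℕ → Fin d → ℝ
  /-- `u k` is what the master keeps from the iterations before `k` as the product of `X` with the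
  parameter -/
  u : ℕ → Fin n → ℝ
  /-- the encoded parameter vector, of which worker `i` holds `v_i` -/
  v : ℕ → Fin m × Fin (numBlocks d q) → ℝ
  /-- the first broadcast -/
  δ : (k : ℕ) → Broadcast₁ (previousChoice U k) → ℝ
  /-- the second broadcast -/
  g : ℕ → Broadcast₂ n → ℝ
  /-- the first answers, as received -/
  recv₁ : ℕ → Fin m → Option (Answer₁ n q → ℝ)
  /-- the second answers, as received -/
  recv₂ : (k : ℕ) → Fin m → Option (Answer₂ (U k) → ℝ)
  w_zero : w 0 = w0
  v_zero : v 0 = rightPinv P.R *ᵥ w0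
  u_zero : u 0 = 0
  δ_zero : ∀ j, δ 0 j = - w0 j
  round₁ : ∀ k, Delivered s t
    (fun i => (P.worker₁ i (previousChoice U k)).eval dl
      (Sum.elim (P.workerMemory X (v k) i) (δ k)))
    (recv₁ k)
  master₁ : ∀ k, Sum.elim (u (k + 1)) (g k) =
    P.master₁.eval dl (Sum.elim (masterMemory (w k) (u k) y) (readAnswers (recv₁ k)))
  v_update : ∀ k i (a : ↥(U k)), v (k + 1) (i, a) =
    (P.worker₂ i (U k)).eval dl
      (Sum.elim (P.workerMemory X (v k) i) (Sum.elim (g k) fun _ => α k)) a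
  v_keep : ∀ k i a, a ∉ U k → v (k + 1) (i, a) = v k (i, a)
  round₂ : ∀ k, Delivered s t (fun i (a : ↥(U k)) => v (k + 1) (i, a)) (recv₂ k)
  master₂ : ∀ k, Sum.elim (fun j : ↥(chunkCoords (N := d) (U k)) => w (k + 1) j) (δ (k + 1)) =
    (P.master₂ (U k)).eval dl
      (Sum.elim (masterMemory (w k) (u (k + 1)) y) (readAnswers (recv₂ k)))
  w_keep : ∀ k j, j ∉ chunkCoords (N := d) (U k) → w (k + 1) j = w k j

/-! Both encodings are Reed-Solomon codes: a codeword lists the values at `0, …, m - 1` of a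
polynomial of degree less than `q`. Since `m - q = 2r`, distinct codewords differ in more than `2r`
places, so `r` wrong answers can be corrected. A missing answer is read as zero and treated as an
error, which is why the condition is `s + t ≤ r`. The block encoding applies the code to each chunk
of `q` coordinates separately, and the master decodes chunk by chunk (`decode_eq`).

Decoding takes quadratic time. Rational interpolation finds a nonzero pair `(N, E)` with `deg N ≤ q
+ r - 1`, `E = 0` or `deg E ≤ r`, and `y E = N` at all `m` points (`exists_isRow_locate`). If `f` is
the true polynomial, `N - f E` vanishes at the at least `q + r` correct positions, so `N = f E`.
Hence `E ≠ 0`, and `y` is correct wherever `E` does not vanish, which happens at `q` points or more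
(`trusted_spec`). The message is then a linear function of `y` that depends only on the zero pattern
of `E`. A computation tree can branch on this pattern with `m` tests and hold one constant matrix
per leaf (`Computes.zeroPattern`, `computes_decode`).

Encoding is cheap because the systematic generator matrix consists of an identity block and `2r`
parity rows `A`. The orthonormal version multiplies it by `(1 + Aᵀ A)^(-1/2)`, which has the form `1
+ N A` and so factors through `2r` dimensions (`exists_normalizer`); its cost remains `O(q r + q)`
per chunk.

The iteration preserves the invariant `Synchronized`: `v = S w`, and the master knows `X` times the
parameter last told to the workers. As `Sᵀ S = 1`, `S` is the pseudoinverse of `R` and `X R v = X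
w`, so both objectives have the same derivative vector. The gradient in `v` is `S` times the
gradient in `w`, and row `(i, a)` of `S` sees only chunk `a`; restricting to `U` therefore matches
restricting to `f(U)` (`S_mulVec_descend`). -/

/-! ### Composition of programs -/

/-- Moves an operand to the even registers. -/
def Operand.toEven {ι : Type} : Operand ι → Operand ι
  | .input i => .input i
  | .const c => .const c
  | .reg k => .reg (2 * k)

/-- Moves an operand to the odd registers, and replaces the inputs by operands in even registers. -/
def Operand.feed {ι κ : Type} (out : κ → Operand ι) : Operand κ → Operand ι
  | .input i => (out i).toEven
  | .const c => .const c
  | .reg k => .reg (2 * k + 1)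

theorem Operand.value_toEven {ι : Type} (x : ι → ℝ) (ρ : ℕ → ℝ) (a : Operand ι) :
    a.toEven.value x ρ = a.value x fun k => ρ (2 * k) := by
  cases a <;> rfl

theorem Operand.value_feed {ι κ : Type} (out : κ → Operand ι) (x : ι → ℝ) (ρ : ℕ → ℝ)
    (a : Operand κ) :
    (a.feed out).value x ρ =
      a.value (fun k => (out k).value x fun j => ρ (2 * j)) fun j => ρ (2 * j + 1) := by
  cases a
  · exact Operand.value_toEven _ _ _
  · rfl
  · rfl

/-- Runs a program in the odd registers, with inputs taken from operands in even registers. -/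
def Prog.feed {ι κ μ : Type} (out : κ → Operand ι) : Prog κ μ → Prog ι μ
  | .ret o => .ret fun k => (o k).feed out
  | .op dst o a b next => .op (2 * dst + 1) o (a.feed out) (b.feed out) (next.feed out)
  | .ifZero a yes no => .ifZero (a.feed out) (yes.feed out) (no.feed out)

/-- Runs `Q` on the output of `P`. -/
def Prog.seq {ι κ μ : Type} : Prog ι κ → Prog κ μ → Prog ι μ
  | .ret out, Q => Q.feed out
  | .op dst o a b next, Q => .op (2 * dst) o a.toEven b.toEven (next.seq Q)
  | .ifZero a yes no, Q => .ifZero a.toEven (yes.seq Q) (no.seq Q)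

/-- Outputs the inputs as well. -/
def Prog.keep {ι κ : Type} : Prog ι κ → Prog ι (ι ⊕ κ)
  | .ret out => .ret (Sum.elim .input out)
  | .op dst o a b next => .op dst o a b next.keep
  | .ifZero a yes no => .ifZero a yes.keep no.keep

theorem Prog.time_feed {ι κ μ : Type} (out : κ → Operand ι) (Q : Prog κ μ) :
    (Q.feed out).time = Q.time := by
  induction Q with
  | ret => rfl
  | op dst o a b next ih => simp [Prog.feed, Prog.time, ih]
  | ifZero a yes no ih₁ ih₂ => simp [Prog.feed, Prog.time, ih₁, ih₂]

theorem Prog.time_seq {ι κ μ : Type} (P : Prog ι κ) (Q : Prog κ μ) :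
    (P.seq Q).time = P.time + Q.time := by
  induction P with
  | ret out => simp [Prog.seq, Prog.time, Prog.time_feed]
  | op dst o a b next ih => simp [Prog.seq, Prog.time, ih]; omega
  | ifZero a yes no ih₁ ih₂ => simp [Prog.seq, Prog.time, ih₁, ih₂]; omega

theorem Prog.time_keep {ι κ : Type} (P : Prog ι κ) : P.keep.time = P.time := by
  induction P with
  | ret out => rfl
  | op dst o a b next ih => simp [Prog.keep, Prog.time, ih]
  | ifZero a yes no ih₁ ih₂ => simp [Prog.keep, Prog.time, ih₁, ih₂]

theorem update_even (ρ : ℕ → ℝ) (i : ℕ) (c : ℝ) :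
    (fun k => Function.update ρ (2 * i) c (2 * k)) =
      Function.update (fun k => ρ (2 * k)) i c := by
  funext k
  by_cases h : k = i
  · subst h; simp
  · rw [Function.update_of_ne h, Function.update_of_ne (by omega)]

theorem update_even_odd (ρ : ℕ → ℝ) (i : ℕ) (c : ℝ) :
    (fun k => Function.update ρ (2 * i) c (2 * k + 1)) = fun k => ρ (2 * k + 1) := by
  funext k
  rw [Function.update_of_ne (by omega)]

theorem update_odd (ρ : ℕ → ℝ) (i : ℕ) (c : ℝ) :
    (fun k => Function.update ρ (2 * i + 1) c (2 * k + 1)) =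
      Function.update (fun k => ρ (2 * k + 1)) i c := by
  funext k
  by_cases h : k = i
  · subst h; simp
  · rw [Function.update_of_ne h, Function.update_of_ne (by omega)]

theorem update_odd_even (ρ : ℕ → ℝ) (i : ℕ) (c : ℝ) :
    (fun k => Function.update ρ (2 * i + 1) c (2 * k)) = fun k => ρ (2 * k) := by
  funext k
  rw [Function.update_of_ne (by omega)]

/-- The fed program writes odd registers only, so the even registers that serve as its inputs keep
their values throughout the run. -/
theorem Prog.evalFrom_feed {ι κ μ : Type} (dl : ℝ → ℝ → ℝ) (x : ι → ℝ) (out : κ → Operand ι)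
    (Q : Prog κ μ) (ρ : ℕ → ℝ) :
    (Q.feed out).evalFrom dl x ρ =
      Q.evalFrom dl (fun k => (out k).value x fun j => ρ (2 * j)) fun j => ρ (2 * j + 1) := by
  induction Q generalizing ρ with
  | ret o => funext k; exact Operand.value_feed _ _ _ _
  | op dst o a b next ih =>
    simp only [Prog.feed, Prog.evalFrom]
    rw [ih]
    simp only [update_odd_even, update_odd, Operand.value_feed]
  | ifZero a yes no ih₁ ih₂ =>
    simp only [Prog.feed, Prog.evalFrom, Operand.value_feed, ih₁, ih₂]

theorem Prog.evalFrom_seq {ι κ μ : Type} (dl : ℝ → ℝ → ℝ) (x : ι → ℝ) (P : Prog ι κ)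
    (Q : Prog κ μ) (ρ : ℕ → ℝ) :
    (P.seq Q).evalFrom dl x ρ =
      Q.evalFrom dl (P.evalFrom dl x fun j => ρ (2 * j)) fun j => ρ (2 * j + 1) := by
  induction P generalizing ρ with
  | ret o => exact Prog.evalFrom_feed _ _ _ _ _
  | op dst o a b next ih =>
    simp only [Prog.seq, Prog.evalFrom]
    rw [ih]
    simp only [update_even_odd, update_even, Operand.value_toEven]
  | ifZero a yes no ih₁ ih₂ =>
    simp only [Prog.seq, Prog.evalFrom, Operand.value_toEven, ih₁, ih₂]
    split_ifs <;> rfl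

theorem Prog.eval_seq {ι κ μ : Type} (dl : ℝ → ℝ → ℝ) (x : ι → ℝ) (P : Prog ι κ)
    (Q : Prog κ μ) : (P.seq Q).eval dl x = Q.eval dl (P.eval dl x) :=
  Prog.evalFrom_seq dl x P Q 0

theorem Prog.evalFrom_keep {ι κ : Type} (dl : ℝ → ℝ → ℝ) (x : ι → ℝ) (P : Prog ι κ)
    (ρ : ℕ → ℝ) : P.keep.evalFrom dl x ρ = Sum.elim x (P.evalFrom dl x ρ) := by
  induction P generalizing ρ with
  | ret o => funext k; cases k <;> rfl
  | op dst o a b next ih => exact ih _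
  | ifZero a yes no ih₁ ih₂ =>
    simp only [Prog.keep, Prog.evalFrom, ih₁, ih₂]
    split_ifs <;> rfl

/-! ### Functions computable within a given time -/

/-- The function `F` of a real vector, which may use the derivative of the loss, is computed by
some program in time `T`. -/
def Computes {ι κ : Type} (T : ℕ) (F : (ℝ → ℝ → ℝ) → (ι → ℝ) → κ → ℝ) : Prop :=
  ∃ P : Prog ι κ, P.time ≤ T ∧ ∀ dl x, P.eval dl x = F dl x

/-- A real-valued function is computable within time `T`. -/
def ComputesReal {ι : Type} (T : ℕ) (f : (ℝ → ℝ → ℝ) → (ι → ℝ) → ℝ) : Prop :=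
  Computes (κ := Unit) T fun dl x _ => f dl x

namespace Computes

variable {ι κ μ : Type} {S T : ℕ}

theorem mono {F : (ℝ → ℝ → ℝ) → (ι → ℝ) → κ → ℝ} (h : Computes S F) (hST : S ≤ T) :
    Computes T F :=
  let ⟨P, hP, hF⟩ := h
  ⟨P, hP.trans hST, hF⟩

theorem comp {F : (ℝ → ℝ → ℝ) → (ι → ℝ) → κ → ℝ} {G : (ℝ → ℝ → ℝ) → (κ → ℝ) → μ → ℝ}
    (hG : Computes T G) (hF : Computes S F) : Computes (S + T) fun dl x => G dl (F dl x) := by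
  obtain ⟨P, hP, hPF⟩ := hF
  obtain ⟨Q, hQ, hQG⟩ := hG
  refine ⟨P.seq Q, by rw [Prog.time_seq]; omega, fun dl x => ?_⟩
  rw [Prog.eval_seq, hPF, hQG]

/-- Reading inputs is free. -/
theorem relabel (σ : κ → ι) : Computes 0 fun _ x k => x (σ k) :=
  ⟨.ret fun k => .input (σ k), le_rfl, fun _ _ => rfl⟩

/-- Reading inputs and constants is free. -/
theorem read (σ : κ → ι ⊕ ℝ) : Computes 0 fun _ x k => Sum.elim x id (σ k) := by
  refine ⟨.ret fun k => Sum.elim .input .const (σ k), le_rfl, fun dl x => ?_⟩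
  funext k
  simp only [Prog.eval, Prog.evalFrom]
  cases σ k <;> rfl

theorem comp_relabel {F : (ℝ → ℝ → ℝ) → (ι → ℝ) → κ → ℝ} (hF : Computes T F) (σ : ι → μ) :
    Computes T fun dl x => F dl fun i => x (σ i) :=
  (hF.comp (relabel σ)).mono (by omega)

theorem relabel_comp {F : (ℝ → ℝ → ℝ) → (ι → ℝ) → κ → ℝ} (hF : Computes T F) (σ : μ → κ) :
    Computes T fun dl x k => F dl x (σ k) :=
  ((relabel σ).comp hF).mono (by omega)

theorem keep {F : (ℝ → ℝ → ℝ) → (ι → ℝ) → κ → ℝ} (hF : Computes T F) :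
    Computes T fun dl x => Sum.elim x (F dl x) := by
  obtain ⟨P, hP, hPF⟩ := hF
  refine ⟨P.keep, by rwa [Prog.time_keep], fun dl x => ?_⟩
  simp only [← hPF]
  exact Prog.evalFrom_keep _ _ _ _

/-- `F` runs first and passes the inputs on, so that `G` can still read them; keeping and
relabelling are free. -/
theorem pair {F : (ℝ → ℝ → ℝ) → (ι → ℝ) → κ → ℝ} {G : (ℝ → ℝ → ℝ) → (ι → ℝ) → μ → ℝ}
    (hF : Computes S F) (hG : Computes T G) :
    Computes (S + T) fun dl x => Sum.elim (F dl x) (G dl x) := by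
  have h := ((hG.comp_relabel (Sum.inl : ι → ι ⊕ κ)).keep.comp hF.keep).relabel_comp
    (Sum.elim (fun k => Sum.inl (Sum.inr k)) Sum.inr : κ ⊕ μ → (ι ⊕ κ) ⊕ μ)
  convert h using 3
  rename_i dl x
  funext k
  cases k <;> rfl

theorem ifZero {F G : (ℝ → ℝ → ℝ) → (ι → ℝ) → κ → ℝ} (i : ι)
    (hF : Computes T F) (hG : Computes T G) :
    Computes (T + 1) fun dl x => open Classical in if x i = 0 then F dl x else G dl x := by
  obtain ⟨P, hP, hPF⟩ := hF
  obtain ⟨Q, hQ, hQG⟩ := hG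
  refine ⟨.ifZero (.input i) P Q, by simp only [Prog.time]; omega, fun dl x => ?_⟩
  simp only [← hPF, ← hQG]
  rfl

/-- Branching on which of some inputs vanish. -/
theorem zeroPattern [DecidableEq κ] (σ : κ → ι) (s : Finset κ)
    (F : Finset κ → (ℝ → ℝ → ℝ) → (ι → ℝ) → μ → ℝ) (hF : ∀ J, Computes T (F J)) :
    Computes (T + s.card) fun dl x =>
      F (open Classical in s.filter fun k => x (σ k) ≠ 0) dl x := by
  induction s using Finset.induction_on generalizing F with
  | empty => simpa using hF ∅
  | insert a s ha ih =>
    -- The outcome of the test is recorded in the shape of the tree: the nonzero branch continues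
    -- with the family `J ↦ F (insert a J)`.
    have h := (ih F hF).ifZero (σ a) (ih (fun J => F (insert a J)) fun J => hF _)
    rw [Finset.card_insert_of_notMem ha, ← add_assoc]
    convert h using 3
    rename_i dl x
    split_ifs with h0
    · rw [Finset.filter_insert, if_neg (by simpa using h0)]
    · rw [Finset.filter_insert, if_pos h0]

theorem pi_finset {α : Type} [DecidableEq α] (s : Finset α) (T : α → ℕ)
    (F : α → (ℝ → ℝ → ℝ) → (ι → ℝ) → κ → ℝ) (hF : ∀ a ∈ s, Computes (T a) (F a)) :
    Computes (∑ a ∈ s, T a) fun dl x (p : α × κ) => if p.1 ∈ s then F p.1 dl x p.2 else 0 := by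
  induction s using Finset.induction_on with
  | empty =>
    have := read (ι := ι) (κ := α × κ) fun _ => Sum.inr 0
    simpa using this
  | insert a s ha ih =>
    have h := ((hF a (Finset.mem_insert_self a s)).pair
      (ih fun b hb => hF b (Finset.mem_insert_of_mem hb))).relabel_comp
      (fun p : α × κ => if p.1 = a then (Sum.inl p.2 : κ ⊕ (α × κ)) else Sum.inr p)
    rw [Finset.sum_insert ha]
    convert h using 4
    rename_i p
    by_cases hp : p.1 = a
    · simp [hp]
    · simp [hp]

/-- Computing one vector after another. -/
theorem pi {α : Type} [Fintype α] {T : α → ℕ}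
    {F : α → (ℝ → ℝ → ℝ) → (ι → ℝ) → κ → ℝ} (hF : ∀ a, Computes (T a) (F a)) :
    Computes (∑ a, T a) fun dl x (p : α × κ) => F p.1 dl x p.2 := by
  classical
  simpa using pi_finset Finset.univ T F fun a _ => hF a

/-- Computing a vector entry by entry. -/
theorem entries [Fintype κ] {T : κ → ℕ} {F : (ℝ → ℝ → ℝ) → (ι → ℝ) → κ → ℝ}
    (hF : ∀ k, ComputesReal (T k) fun dl x => F dl x k) : Computes (∑ k, T k) F :=
  (pi hF).relabel_comp fun k => (k, ())

end Computes

namespace ComputesReal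

variable {ι : Type} {S T : ℕ} {f g : (ℝ → ℝ → ℝ) → (ι → ℝ) → ℝ}

theorem mono (h : ComputesReal S f) (hST : S ≤ T) : ComputesReal T f :=
  Computes.mono h hST

theorem input (i : ι) : ComputesReal 0 fun _ x => x i :=
  Computes.relabel _

theorem const (c : ℝ) : ComputesReal (ι := ι) 0 fun _ _ => c :=
  Computes.read fun _ => Sum.inr c

theorem op (o : RealOp) (hf : ComputesReal S f) (hg : ComputesReal T g) :
    ComputesReal (S + T + 1) fun dl x => o.value dl (f dl x) (g dl x) := by
  have h : Computes (ι := Unit ⊕ Unit) (κ := Unit) 1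
      fun dl x _ => o.value dl (x (Sum.inl ())) (x (Sum.inr ())) :=
    ⟨.op 0 o (.input (Sum.inl ())) (.input (Sum.inr ())) (.ret fun _ => .reg 0), le_rfl,
      fun dl x => by
        funext k
        simp [Prog.eval, Prog.evalFrom, Operand.value]⟩
  exact h.comp (Computes.pair hf hg)

theorem add (hf : ComputesReal S f) (hg : ComputesReal T g) :
    ComputesReal (S + T + 1) fun dl x => f dl x + g dl x :=
  op .add hf hg

theorem sub (hf : ComputesReal S f) (hg : ComputesReal T g) :
    ComputesReal (S + T + 1) fun dl x => f dl x - g dl x :=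
  op .sub hf hg

theorem mul (hf : ComputesReal S f) (hg : ComputesReal T g) :
    ComputesReal (S + T + 1) fun dl x => f dl x * g dl x :=
  op .mul hf hg

theorem div (hf : ComputesReal S f) (hg : ComputesReal T g) :
    ComputesReal (S + T + 1) fun dl x => f dl x / g dl x :=
  op .div hf hg

theorem lossDeriv (hf : ComputesReal S f) (hg : ComputesReal T g) :
    ComputesReal (S + T + 1) fun dl x => dl (f dl x) (g dl x) :=
  op .lossDeriv hf hg

theorem sum {α : Type} (s : Finset α) {f : α → (ℝ → ℝ → ℝ) → (ι → ℝ) → ℝ}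
    (hf : ∀ a ∈ s, ComputesReal T (f a)) :
    ComputesReal (s.card * (T + 1)) fun dl x => ∑ a ∈ s, f a dl x := by
  classical
  induction s using Finset.induction_on with
  | empty => simpa using const (ι := ι) 0
  | insert a s ha ih =>
    simp only [Finset.sum_insert ha, Finset.card_insert_of_notMem ha]
    exact ((hf a (Finset.mem_insert_self a s)).add
      (ih fun b hb => hf b (Finset.mem_insert_of_mem hb))).mono (by ring_nf; omega)

/-- An inner product with a vector of constants. -/
theorem dotConst {α : Type} [Fintype α] (c : α → ℝ) (σ : α → ι) :
    ComputesReal (2 * Fintype.card α) fun _ x => ∑ a, c a * x (σ a) :=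
  (sum Finset.univ fun a _ => (const (c a)).mul (input (σ a))).mono
    (by rw [Finset.card_univ]; omega)

end ComputesReal

/-! ### Evaluation codes -/

open Polynomial in
/-- The encoding `u ↦ B u` is injective, and every codeword lists the values at `0, …, m - 1` of a
polynomial of degree less than `q`. -/
structure IsEvalCode {m q : ℕ} (B : Matrix (Fin m) (Fin q) ℝ) : Prop where
  injective : ∀ u, B *ᵥ u = 0 → u = 0
  exists_poly : ∀ u, ∃ f : ℝ[X], f.natDegree < q ∧ ∀ j : Fin m, (B *ᵥ u) j = f.eval (j : ℝ)

theorem injective_cast_fin (m : ℕ) : Function.Injective fun j : Fin m => ((j : ℕ) : ℝ) := by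
  intro i j h
  exact Fin.ext (Nat.cast_injective h)

open Polynomial in
theorem eq_zero_of_eval_fin {m : ℕ} (f : ℝ[X]) (J : Finset (Fin m)) (hf : f.natDegree < J.card)
    (h : ∀ j ∈ J, f.eval ((j : ℕ) : ℝ) = 0) : f = 0 := by
  classical
  refine Polynomial.eq_zero_of_natDegree_lt_card_of_eval_eq_zero' f
    (J.image fun j : Fin m => ((j : ℕ) : ℝ)) ?_ ?_
  · intro x hx
    obtain ⟨j, hj, rfl⟩ := Finset.mem_image.1 hx
    exact h j hj
  · rwa [Finset.card_image_of_injective _ (injective_cast_fin m)]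

/-- The distance property of the code: a polynomial of degree less than `q` with `q` roots is zero.
-/
theorem IsEvalCode.eq_zero {m q : ℕ} {B : Matrix (Fin m) (Fin q) ℝ} (hB : IsEvalCode B)
    (J : Finset (Fin m)) (hJ : q ≤ J.card) (u : Fin q → ℝ) (h : ∀ j ∈ J, (B *ᵥ u) j = 0) :
    u = 0 := by
  obtain ⟨f, hf, hBf⟩ := hB.exists_poly u
  have hf0 : f = 0 := eq_zero_of_eval_fin f J (by omega) fun j hj => by rw [← hBf, h j hj]
  refine hB.injective u ?_
  funext j
  rw [hBf, hf0]
  simp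

/-- From any `q` correct entries of a codeword the message is recovered by a fixed matrix. -/
theorem IsEvalCode.exists_recover {m q : ℕ} {B : Matrix (Fin m) (Fin q) ℝ} (hB : IsEvalCode B) :
    ∃ D : Finset (Fin m) → Matrix (Fin q) (Fin m) ℝ, ∀ J, q ≤ J.card → ∀ u y,
      (∀ j ∈ J, y j = (B *ᵥ u) j) → D J *ᵥ y = u := by
  classical
  have key : ∀ J : Finset (Fin m), ∃ D : Matrix (Fin q) (Fin m) ℝ, q ≤ J.card → ∀ u y,
      (∀ j ∈ J, y j = (B *ᵥ u) j) → D *ᵥ y = u := by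
    intro J
    by_cases hJ : q ≤ J.card
    swap
    · exact ⟨0, fun h => absurd h hJ⟩
    -- The mask makes the recovery matrix ignore the entries outside `J`, which may be corrupt. The
    -- masked code is still injective and so has a left inverse.
    let δ : Matrix (Fin m) (Fin m) ℝ := diagonal fun j => if j ∈ J then 1 else 0
    have hδ : ∀ y j, (δ *ᵥ y) j = if j ∈ J then y j else 0 := by
      intro y j
      simp [δ, mulVec_diagonal]
    have hker : LinearMap.ker (Matrix.toLin' (δ * B)) = ⊥ := by
      rw [LinearMap.ker_eq_bot']
      intro u hu
      refine hB.eq_zero J hJ u fun j hj => ?_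
      have := congrFun hu j
      rw [Matrix.toLin'_apply, ← mulVec_mulVec, hδ, if_pos hj] at this
      exact this
    obtain ⟨l, hl⟩ := LinearMap.exists_leftInverse_of_injective _ hker
    refine ⟨LinearMap.toMatrix' l * δ, fun _ u y hy => ?_⟩
    have : δ *ᵥ y = (δ * B) *ᵥ u := by
      rw [← mulVec_mulVec]
      funext j
      rw [hδ, hδ]
      split_ifs with hj
      · exact hy j hj
      · rfl
    rw [← mulVec_mulVec, this, ← Matrix.toLin'_apply (δ * B), LinearMap.toMatrix'_mulVec]
    exact LinearMap.congr_fun hl u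
  choose D hD using key
  exact ⟨D, hD⟩

/-! ### Locating errors by rational interpolation -/

/-- Index set for the values of a pair of polynomials at `0, …, m - 1`. -/
abbrev RowIndex (m : ℕ) : Type := Fin m ⊕ Fin m

/-- Multiplication by `X - i`. -/
def shiftRow {m : ℕ} (i : Fin m) (p : RowIndex m → ℝ) : RowIndex m → ℝ :=
  fun j => (((Sum.elim id id j : Fin m) : ℕ) - (i : ℕ) : ℝ) * p j

/-- Subtracts a multiple of the row `p` from `o`, such that the residual at `i` vanishes. -/
noncomputable def cancelRow {m : ℕ} (i : Fin m) (p o : RowIndex m → ℝ) : RowIndex m → ℝ :=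
  fun j => o j - o (Sum.inl i) / p (Sum.inl i) * p j

/-- Processes the interpolation points in the list. The degree bound of `o` exceeds that of
`p` by `g`. -/
noncomputable def locate {m : ℕ} :
    List (Fin m) → ℕ → (RowIndex m → ℝ) → (RowIndex m → ℝ) → RowIndex m → ℝ
  | [], _, p, _ => p
  | i :: l, g, p, o =>
      open Classical in
      if p (Sum.inl i) = 0 then locate l (g + 1) p (shiftRow i o)
      else if g = 0 then locate l 1 (cancelRow i p o) (shiftRow i p)
      else locate l (g - 1) (shiftRow i p) (cancelRow i p o)

open Polynomial in
/-- The row `p` holds the residuals `y E - N` and the values of `E`, and `a` bounds the degree of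
`N` and, shifted by `q - 1`, of `E`. -/
structure IsRow {m : ℕ} (y : Fin m → ℝ) (q a : ℕ) (N E : ℝ[X]) (p : RowIndex m → ℝ) : Prop where
  residual : ∀ j : Fin m, p (Sum.inl j) = y j * E.eval (j : ℝ) - N.eval (j : ℝ)
  value : ∀ j : Fin m, p (Sum.inr j) = E.eval (j : ℝ)
  degree_num : N.natDegree ≤ a
  degree_den : (E * X ^ (q - 1)).natDegree ≤ a

namespace IsRow

open Polynomial

variable {m : ℕ} {y : Fin m → ℝ} {q a b : ℕ} {N E N' E' : ℝ[X]} {p o : RowIndex m → ℝ}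

theorem mono (h : IsRow y q a N E p) (hab : a ≤ b) : IsRow y q b N E p :=
  ⟨h.residual, h.value, h.degree_num.trans hab, h.degree_den.trans hab⟩

theorem shift (h : IsRow y q a N E p) (i : Fin m) :
    IsRow y q (a + 1) ((X - C ((i : ℕ) : ℝ)) * N) ((X - C ((i : ℕ) : ℝ)) * E) (shiftRow i p) where
  residual j := by
    simp only [shiftRow, Sum.elim_inl, id, h.residual, eval_mul, eval_sub, eval_X, eval_C]
    ring
  value j := by
    simp only [shiftRow, Sum.elim_inr, id, h.value, eval_mul, eval_sub, eval_X, eval_C]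
  degree_num := by
    have h1 := natDegree_mul_le (p := X - C ((i : ℕ) : ℝ)) (q := N)
    have h2 := h.degree_num
    rw [natDegree_X_sub_C] at h1
    omega
  degree_den := by
    have h1 := natDegree_mul_le (p := X - C ((i : ℕ) : ℝ)) (q := E * X ^ (q - 1))
    have h2 := h.degree_den
    rw [natDegree_X_sub_C] at h1
    rw [mul_assoc]
    omega

/-- Residuals, values and polynomials all depend linearly on the row. Because `a ≤ b`, subtracting a
multiple of the lower row costs no degree. -/
theorem cancel (h : IsRow y q a N E p) (h' : IsRow y q b N' E' o) (hab : a ≤ b) (i : Fin m) :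
    IsRow y q b (N' - C (o (Sum.inl i) / p (Sum.inl i)) * N)
      (E' - C (o (Sum.inl i) / p (Sum.inl i)) * E) (cancelRow i p o) where
  residual j := by
    simp only [cancelRow, h.residual, h'.residual, eval_mul, eval_sub, eval_C]
    ring
  value j := by
    simp only [cancelRow, h.value, h'.value, eval_mul, eval_sub, eval_C]
  degree_num := by
    refine (natDegree_sub_le _ _).trans (max_le h'.degree_num ?_)
    exact (natDegree_C_mul_le _ _).trans (h.degree_num.trans hab)
  degree_den := by
    rw [sub_mul, mul_assoc]
    refine (natDegree_sub_le _ _).trans (max_le h'.degree_den ?_)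
    exact (natDegree_C_mul_le _ _).trans (h.degree_den.trans hab)

end IsRow

theorem shiftRow_self {m : ℕ} (i : Fin m) (p : RowIndex m → ℝ) :
    shiftRow i p (Sum.inl i) = 0 := by
  simp [shiftRow]

theorem shiftRow_eq_zero {m : ℕ} {i j : Fin m} {p : RowIndex m → ℝ} (h : p (Sum.inl j) = 0) :
    shiftRow i p (Sum.inl j) = 0 := by
  simp [shiftRow, h]

theorem cancelRow_self {m : ℕ} {i : Fin m} {p : RowIndex m → ℝ} (h : p (Sum.inl i) ≠ 0)
    (o : RowIndex m → ℝ) : cancelRow i p o (Sum.inl i) = 0 := by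
  simp [cancelRow, div_mul_cancel₀ _ h]

theorem cancelRow_eq_zero {m : ℕ} {i j : Fin m} {p o : RowIndex m → ℝ} (h : p (Sum.inl j) = 0)
    (h' : o (Sum.inl j) = 0) : cancelRow i p o (Sum.inl j) = 0 := by
  simp [cancelRow, h, h']

open Polynomial in
/-- Interpolation at the points of the list yields a nonzero pair of polynomials of small degree
whose residuals vanish. -/
theorem exists_isRow_locate {m : ℕ} {y : Fin m → ℝ} {q A : ℕ} (l : List (Fin m)) :
    ∀ {g a : ℕ} {N E N' E' : ℝ[X]} {p o : RowIndex m → ℝ} {s : Set (Fin m)},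
    IsRow y q a N E p → IsRow y q (a + g) N' E' o → N * E' - N' * E ≠ 0 →
    (∀ j ∈ s, p (Sum.inl j) = 0 ∧ o (Sum.inl j) = 0) → 2 * a + g + l.length ≤ 2 * A + 1 →
    ∃ N'' E'', (N'' ≠ 0 ∨ E'' ≠ 0) ∧ IsRow y q A N'' E'' (locate l g p o) ∧
      ∀ j, j ∈ s ∨ j ∈ l → locate l g p o (Sum.inl j) = 0 := by
  induction l with
  | nil =>
    intro g a N E N' E' p o s hp ho hdet hs hA
    -- With no points left, `2 * a + g ≤ 2 * A + 1` forces `a ≤ A`; the nonzero determinant rules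
    -- out `N = E = 0`.
    refine ⟨N, E, ?_, hp.mono (by simp at hA; omega), fun j hj => (hs j (by simpa using hj)).1⟩
    by_contra! h
    simp [h.1, h.2] at hdet
  | cons i l ih =>
    -- Every case below raises `2 * a + g`, the sum of the two degree bounds, by exactly one and
    -- multiplies the determinant `N E' - N' E` by `±(X - i)`.
    intro g a N E N' E' p o s hp ho hdet hs hA
    have hX : (X - C ((i : ℕ) : ℝ)) ≠ 0 := X_sub_C_ne_zero _
    have hmem : ∀ j, j ∈ s ∨ j ∈ i :: l → j ∈ insert i s ∨ j ∈ l := by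
      intro j hj
      simp only [List.mem_cons] at hj
      simp only [Set.mem_insert_iff]
      tauto
    rw [List.length_cons] at hA
    by_cases h0 : p (Sum.inl i) = 0
    · rw [show locate (i :: l) g p o = locate l (g + 1) p (shiftRow i o) by
        simp only [locate]; rw [if_pos h0]]
      obtain ⟨N'', E'', h1, h2, h3⟩ := ih (g := g + 1) (s := insert i s) hp (ho.shift i)
        (by
          intro h
          apply mul_ne_zero hX hdet
          linear_combination h)
        (by
          rintro j (rfl | hj)
          · exact ⟨h0, shiftRow_self _ _⟩
          · exact ⟨(hs j hj).1, shiftRow_eq_zero (hs j hj).2⟩)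
        (by omega)
      exact ⟨N'', E'', h1, h2, fun j hj => h3 j (hmem j hj)⟩
    · have hc := hp.cancel ho (Nat.le_add_right a g) i
      have hsh := hp.shift i
      -- For `g = 0` the rows trade places: the shifted row would otherwise have the larger degree
      -- bound while standing first.
      rcases Nat.eq_zero_or_pos g with rfl | hg
      · rw [show locate (i :: l) 0 p o = locate l 1 (cancelRow i p o) (shiftRow i p) by
          simp only [locate]; rw [if_neg h0, if_pos trivial]]
        obtain ⟨N'', E'', h1, h2, h3⟩ := ih (s := insert i s) hc hsh
          (by
            intro h
            apply mul_ne_zero hX hdet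
            linear_combination -h)
          (by
            rintro j (rfl | hj)
            · exact ⟨cancelRow_self h0 _, shiftRow_self _ _⟩
            · exact ⟨cancelRow_eq_zero (hs j hj).1 (hs j hj).2, shiftRow_eq_zero (hs j hj).1⟩)
          (by omega)
        exact ⟨N'', E'', h1, h2, fun j hj => h3 j (hmem j hj)⟩
      · rw [show locate (i :: l) g p o = locate l (g - 1) (shiftRow i p) (cancelRow i p o) by
          simp only [locate]; rw [if_neg h0, if_neg (by omega)]]
        obtain ⟨N'', E'', h1, h2, h3⟩ := ih (s := insert i s) hsh
          (hc.mono (b := a + 1 + (g - 1)) (by omega))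
          (by
            intro h
            apply mul_ne_zero hX hdet
            linear_combination h)
          (by
            rintro j (rfl | hj)
            · exact ⟨shiftRow_self _ _, cancelRow_self h0 _⟩
            · exact ⟨shiftRow_eq_zero (hs j hj).1, cancelRow_eq_zero (hs j hj).1 (hs j hj).2⟩)
          (by omega)
        exact ⟨N'', E'', h1, h2, fun j hj => h3 j (hmem j hj)⟩

/-- The initial row `(N, E) = (1, 0)`. -/
def numRow (m : ℕ) : RowIndex m → ℝ := Sum.elim (fun _ => -1) fun _ => 0

/-- The initial row `(N, E) = (0, 1)`. -/
def denRow {m : ℕ} (y : Fin m → ℝ) : RowIndex m → ℝ := Sum.elim y fun _ => 1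

/-- The values of an error locator polynomial for the received word `y`. -/
noncomputable def errorLocator {m : ℕ} (q : ℕ) (y : Fin m → ℝ) (j : Fin m) : ℝ :=
  locate (List.finRange m) (q - 1) (numRow m) (denRow y) (Sum.inr j)

open Classical in
/-- The positions at which the error locator shows no error. -/
noncomputable def trusted {m : ℕ} (q : ℕ) (y : Fin m → ℝ) : Finset (Fin m) :=
  Finset.univ.filter fun j => errorLocator q y j ≠ 0

/-- Decoding by the matrix which belongs to the set of trusted positions. -/
noncomputable def decode {m q : ℕ} (D : Finset (Fin m) → Matrix (Fin q) (Fin m) ℝ)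
    (y : Fin m → ℝ) : Fin q → ℝ :=
  D (trusted q y) *ᵥ y

-- The errors are located by the key equation `N = f E`: a correct value can be read off wherever
-- `E` is nonzero, and `E` has too few roots to hide more than `2r` positions.
open Classical Polynomial in
theorem trusted_spec {m q r : ℕ} (hq : 0 < q) (hm : m = q + 2 * r) {f : ℝ[X]}
    (hf : f.natDegree < q) {y : Fin m → ℝ}
    (hy : (Finset.univ.filter fun j : Fin m => y j ≠ f.eval ((j : ℕ) : ℝ)).card ≤ r) :
    q ≤ (trusted q y).card ∧ ∀ j ∈ trusted q y, y j = f.eval ((j : ℕ) : ℝ) := by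
  -- The degree bounds start with sum `q - 1` and grow by `m = q + 2r` in total, which gives `2 * (q
  -- + r - 1) + 1`; this determines `A`.
  obtain ⟨N, E, hNE, hrow, hz⟩ := exists_isRow_locate (y := y) (q := q) (A := q + r - 1)
    (List.finRange m) (g := q - 1) (a := 0) (N := 1) (E := 0) (N' := 0) (E' := 1)
    (p := numRow m) (o := denRow y) (s := ∅)
    ⟨fun j => by simp [numRow], fun j => by simp [numRow], by simp, by simp⟩
    ⟨fun j => by simp [denRow], fun j => by simp [denRow], by simp, by simp⟩
    (by simp) (by simp) (by rw [List.length_finRange]; omega)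
  have hres : ∀ j : Fin m, y j * E.eval ((j : ℕ) : ℝ) = N.eval ((j : ℕ) : ℝ) := fun j =>
    sub_eq_zero.1 ((hrow.residual j).symm.trans (hz j (Or.inr (List.mem_finRange j))))
  have hEdeg : E = 0 ∨ E.natDegree ≤ r := by
    rcases eq_or_ne E 0 with h | h
    · exact Or.inl h
    · have := hrow.degree_den
      rw [natDegree_mul h (pow_ne_zero _ X_ne_zero), natDegree_X_pow] at this
      exact Or.inr (by omega)
  have hfE : (f * E).natDegree ≤ q + r - 1 := by
    rcases hEdeg with h | h
    · simp [h]
    · have := natDegree_mul_le (p := f) (q := E)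
      omega
  have hcard := Finset.card_filter_add_card_filter_not (s := (Finset.univ : Finset (Fin m)))
    (fun j : Fin m => y j ≠ f.eval ((j : ℕ) : ℝ))
  rw [Finset.card_univ, Fintype.card_fin] at hcard
  have hN : N = f * E := by
    refine sub_eq_zero.1 (eq_zero_of_eval_fin _
      (Finset.univ.filter fun j : Fin m => ¬ y j ≠ f.eval ((j : ℕ) : ℝ)) ?_ ?_)
    · refine (natDegree_sub_le _ _).trans_lt ?_
      have := max_le hrow.degree_num hfE
      omega
    · intro j hj
      have hj' : y j = f.eval ((j : ℕ) : ℝ) := by simpa using hj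
      rw [eval_sub, eval_mul, ← hres, hj', sub_self]
  -- If `E` were zero, then `N = f E` would be zero too, but the pair is nonzero.
  have hE : E ≠ 0 := by
    rintro rfl
    simp [hN] at hNE
  have htrust : ∀ j, j ∈ trusted q y ↔ E.eval ((j : ℕ) : ℝ) ≠ 0 := by
    intro j
    simp only [trusted, errorLocator, Finset.mem_filter, Finset.mem_univ, true_and, hrow.value]
  refine ⟨?_, fun j hj => ?_⟩
  · have hcard' := Finset.card_filter_add_card_filter_not (s := (Finset.univ : Finset (Fin m)))
      (fun j : Fin m => errorLocator q y j ≠ 0)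
    rw [Finset.card_univ, Fintype.card_fin] at hcard'
    by_contra! hlt
    have hlt' : (Finset.univ.filter fun j : Fin m => errorLocator q y j ≠ 0).card < q := hlt
    refine hE (eq_zero_of_eval_fin E
      (Finset.univ.filter fun j : Fin m => ¬ errorLocator q y j ≠ 0) ?_ ?_)
    · rcases hEdeg with h | h
      · exact absurd h hE
      · omega
    · intro j hj
      by_contra h
      have := (htrust j).2 h
      simp only [trusted, Finset.mem_filter] at this hj
      exact hj.2 this.2
  · have h := hres j
    rw [hN, eval_mul] at h
    exact mul_right_cancel₀ ((htrust j).1 hj) h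

open Classical in
/-- The decoder corrects up to `r` errors. -/
theorem decode_eq {m q r : ℕ} (hq : 0 < q) (hm : m = q + 2 * r) {B : Matrix (Fin m) (Fin q) ℝ}
    (hB : IsEvalCode B) {D : Finset (Fin m) → Matrix (Fin q) (Fin m) ℝ}
    (hD : ∀ J, q ≤ J.card → ∀ u y, (∀ j ∈ J, y j = (B *ᵥ u) j) → D J *ᵥ y = u)
    {u : Fin q → ℝ} {y : Fin m → ℝ}
    (hy : (Finset.univ.filter fun j : Fin m => y j ≠ (B *ᵥ u) j).card ≤ r) :
    decode D y = u := by
  obtain ⟨f, hf, hBf⟩ := hB.exists_poly u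
  simp only [hBf] at hy
  obtain ⟨h1, h2⟩ := trusted_spec hq hm hf hy
  exact hD _ h1 _ _ fun j hj => by rw [hBf, h2 j hj]

/-! ### Running time of the decoder -/

theorem computes_shiftRow {ι : Type} {m : ℕ} (i : Fin m) (σ : RowIndex m → ι) :
    Computes (2 * m) fun _ x => shiftRow i fun j => x (σ j) := by
  refine (Computes.entries (T := fun _ => 1) fun j =>
    (ComputesReal.const _).mul (ComputesReal.input (σ j))).mono ?_
  simp
  omega

theorem computes_cancelRow {ι : Type} {m : ℕ} (i : Fin m) (σ τ : RowIndex m → ι) :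
    Computes (6 * m) fun _ x => cancelRow i (fun j => x (σ j)) fun j => x (τ j) := by
  refine (Computes.entries (T := fun _ => 3) fun j =>
    (ComputesReal.input (τ j)).sub (((ComputesReal.input (τ (Sum.inl i))).div
      (ComputesReal.input (σ (Sum.inl i)))).mul (ComputesReal.input (σ j)))).mono ?_
  simp
  omega

/-- A point costs at most one shift (`2m`), one cancellation (`6m`) and one zero test. The
comparison `g = 0` is free, since `g` is known when the tree is built. -/
theorem computes_locate {m : ℕ} (l : List (Fin m)) (g : ℕ) :
    Computes (l.length * (8 * m + 1)) fun _ (x : RowIndex m ⊕ RowIndex m → ℝ) =>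
      locate l g (fun j => x (Sum.inl j)) fun j => x (Sum.inr j) := by
  induction l generalizing g with
  | nil => exact (Computes.relabel _).mono (Nat.zero_le _)
  | cons i l ih =>
    have h1 := ((ih (g + 1)).comp ((Computes.relabel Sum.inl).pair
      (computes_shiftRow i Sum.inr))).mono (T := l.length * (8 * m + 1) + 8 * m) (by omega)
    have h2 := ((ih 1).comp ((computes_cancelRow i Sum.inl Sum.inr).pair
      (computes_shiftRow i Sum.inl))).mono (T := l.length * (8 * m + 1) + 8 * m) (by omega)
    have h3 := ((ih (g - 1)).comp ((computes_shiftRow i Sum.inl).pair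
      (computes_cancelRow i Sum.inl Sum.inr))).mono
        (T := l.length * (8 * m + 1) + 8 * m) (by omega)
    have h23 : Computes (l.length * (8 * m + 1) + 8 * m)
        fun _ (x : RowIndex m ⊕ RowIndex m → ℝ) =>
          if g = 0 then locate l 1 (cancelRow i (fun j => x (Sum.inl j)) fun j => x (Sum.inr j))
            (shiftRow i fun j => x (Sum.inl j))
          else locate l (g - 1) (shiftRow i fun j => x (Sum.inl j))
            (cancelRow i (fun j => x (Sum.inl j)) fun j => x (Sum.inr j)) := by
      split_ifs
      · exact h2
      · exact h3
    refine (Computes.ifZero (Sum.inl (Sum.inl i)) h1 h23).mono ?_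
    rw [List.length_cons]
    linarith

theorem computes_mulVec {ι : Type} {a b : ℕ} (D : Matrix (Fin a) (Fin b) ℝ) (σ : Fin b → ι) :
    Computes (a * (2 * b)) fun _ x => D *ᵥ fun j => x (σ j) := by
  refine (Computes.entries (T := fun _ => 2 * b) fun k =>
    (ComputesReal.dotConst (D k) σ).mono (by simp)).mono ?_
  simp

/-- The decoder takes quadratic time. -/
theorem computes_decode {m q : ℕ} (hqm : q ≤ m)
    (D : Finset (Fin m) → Matrix (Fin q) (Fin m) ℝ) :
    Computes (12 * m ^ 2) fun _ (y : Fin m → ℝ) => decode D y := by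
  rcases Nat.eq_zero_or_pos m with rfl | hm
  · obtain rfl : q = 0 := by omega
    convert (Computes.relabel Fin.elim0).mono (Nat.zero_le _) using 3
  have hinit : Computes 0 fun _ (y : Fin m → ℝ) => Sum.elim (numRow m) (denRow y) := by
    have := Computes.read (ι := Fin m) (κ := RowIndex m ⊕ RowIndex m)
      (Sum.elim (Sum.elim (fun _ => Sum.inr (-1)) fun _ => Sum.inr 0)
        (Sum.elim Sum.inl fun _ => Sum.inr 1))
    convert this using 4
    rename_i j
    rcases j with (j | j) | (j | j) <;> rfl
  have hloc := ((computes_locate (List.finRange m) (q - 1)).comp hinit).keep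
  have hpat := Computes.zeroPattern (ι := Fin m ⊕ RowIndex m) (κ := Fin m)
    (fun j => Sum.inr (Sum.inr j)) Finset.univ
    (fun J _ x => D J *ᵥ fun j => x (Sum.inl j)) fun J => computes_mulVec (D J) _
  -- The budget: `m (8m + 1)` for the locator, `m` zero tests, and `2 q m` for the product with the
  -- matrix at the leaf.
  refine (hpat.comp hloc).mono ?_
  rw [List.length_finRange, Finset.card_univ, Fintype.card_fin]
  nlinarith

/-! ### The systematic code and its orthonormal version -/

open Polynomial in
/-- The matrix that extends the values of a polynomial of degree less than `q` at `0, …, q - 1`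
to its values at `0, …, m - 1`. -/
noncomputable def extensionMatrix (m q : ℕ) : Matrix (Fin m) (Fin q) ℝ :=
  fun j c => (Lagrange.basis Finset.univ (fun c : Fin q => ((c : ℕ) : ℝ)) c).eval ((j : ℕ) : ℝ)

open Polynomial in
theorem extensionMatrix_mulVec {m q : ℕ} (u : Fin q → ℝ) (j : Fin m) :
    (extensionMatrix m q *ᵥ u) j =
      (Lagrange.interpolate Finset.univ (fun c : Fin q => ((c : ℕ) : ℝ)) u).eval
        ((j : ℕ) : ℝ) := by
  simp only [mulVec, dotProduct, extensionMatrix, Lagrange.interpolate_apply, eval_finsetSum,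
    eval_mul, eval_C]
  exact Finset.sum_congr rfl fun _ _ => mul_comm _ _

theorem extensionMatrix_mulVec_of_lt {m q : ℕ} (u : Fin q → ℝ) (j : Fin m) (hj : (j : ℕ) < q) :
    (extensionMatrix m q *ᵥ u) j = u ⟨j, hj⟩ := by
  rw [extensionMatrix_mulVec]
  exact Lagrange.eval_interpolate_at_node u (v := fun c : Fin q => ((c : ℕ) : ℝ))
    (injective_cast_fin q).injOn (Finset.mem_univ (⟨j, hj⟩ : Fin q))

theorem extensionMatrix_of_lt {m q : ℕ} (j : Fin m) (hj : (j : ℕ) < q) (c : Fin q) :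
    extensionMatrix m q j c = (1 : Matrix (Fin q) (Fin q) ℝ) ⟨j, hj⟩ c := by
  have h := extensionMatrix_mulVec_of_lt (m := m) (Pi.single c 1) j hj
  rw [mulVec_single_one, Pi.single_apply] at h
  rw [Matrix.one_apply]
  exact h

theorem isEvalCode_extensionMatrix {m q : ℕ} (hq : 0 < q) (hqm : q ≤ m) :
    IsEvalCode (extensionMatrix m q) where
  injective u hu := by
    funext c
    rw [← extensionMatrix_mulVec_of_lt (m := m) u ⟨c, c.2.trans_le hqm⟩ c.2, hu]
    rfl
  exists_poly u := by
    refine ⟨_, ?_, extensionMatrix_mulVec u⟩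
    have h := Lagrange.degree_interpolate_lt (s := Finset.univ) u
      (v := fun c : Fin q => ((c : ℕ) : ℝ)) (injective_cast_fin q).injOn
    rw [Finset.card_univ, Fintype.card_fin] at h
    rcases eq_or_ne (Lagrange.interpolate Finset.univ (fun c : Fin q => ((c : ℕ) : ℝ)) u) 0
      with h0 | h0
    · rwa [h0, Polynomial.natDegree_zero]
    · exact (Polynomial.natDegree_lt_iff_degree_lt h0).2 h

/-- The rows of the systematic code that carry redundancy. -/
abbrev ParityIndex (m q : ℕ) : Type := {j : Fin m // ¬ (j : ℕ) < q}

/-- The redundant part of the systematic code. -/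
noncomputable def parityMatrix (m q : ℕ) : Matrix (ParityIndex m q) (Fin q) ℝ :=
  fun j c => extensionMatrix m q j c

theorem sum_systematic {m q : ℕ} (hqm : q ≤ m) (f : Fin q → ℝ) :
    ∑ j : {j : Fin m // (j : ℕ) < q}, f ⟨j, j.2⟩ = ∑ c, f c :=
  Fintype.sum_equiv ⟨fun j => ⟨j, j.2⟩, fun c => ⟨⟨c, c.2.trans_le hqm⟩, c.2⟩,
    fun _ => rfl, fun _ => rfl⟩ _ _ fun _ => rfl

theorem card_parityIndex {m q : ℕ} (hqm : q ≤ m) : Fintype.card (ParityIndex m q) = m - q := by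
  have h1 : Fintype.card {j : Fin m // (j : ℕ) < q} = q := by
    rw [Fintype.card_congr (⟨fun j => ⟨j, j.2⟩, fun c => ⟨⟨c, c.2.trans_le hqm⟩, c.2⟩,
      fun _ => rfl, fun _ => rfl⟩ : {j : Fin m // (j : ℕ) < q} ≃ Fin q), Fintype.card_fin]
  rw [Fintype.card_subtype_compl, h1, Fintype.card_fin]

/-- The first `q` rows form an identity matrix; only the parity rows contribute anything else to the
Gram matrix. -/
theorem transpose_mul_extensionMatrix {m q : ℕ} (hqm : q ≤ m) :
    (extensionMatrix m q)ᵀ * extensionMatrix m q =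
      1 + (parityMatrix m q)ᵀ * parityMatrix m q := by
  ext c c'
  rw [Matrix.add_apply, mul_apply, mul_apply,
    ← Fintype.sum_subtype_add_sum_subtype (fun j : Fin m => (j : ℕ) < q)]
  congr 1
  rw [Finset.sum_congr rfl fun (j : {j : Fin m // (j : ℕ) < q}) _ => by
    rw [transpose_apply, extensionMatrix_of_lt _ j.2, extensionMatrix_of_lt _ j.2]]
  rw [sum_systematic hqm fun j => (1 : Matrix (Fin q) (Fin q) ℝ) j c *
    (1 : Matrix (Fin q) (Fin q) ℝ) j c']
  simp [Matrix.one_apply, eq_comm]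

-- The square root is taken on the side of `A * Aᵀ`, whose size is the number of parity rows. `W +
-- 1` is invertible because `W` is positive semidefinite.
open scoped MatrixOrder Matrix.Norms.L2Operator in
theorem exists_sqrt_one_add {ρ κ : Type} [Fintype ρ] [Fintype κ] [DecidableEq ρ]
    (A : Matrix ρ κ ℝ) :
    ∃ W : Matrix ρ ρ ℝ, Wᵀ = W ∧ W * W = 1 + A * Aᵀ ∧ IsUnit W ∧ IsUnit (W + 1) := by
  have hQ : (A * Aᵀ).PosSemidef := by
    simpa using posSemidef_self_mul_conjTranspose A
  have h1 : (1 + A * Aᵀ).PosDef := PosDef.one.add_posSemidef hQ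
  have hW : (CFC.sqrt (1 + A * Aᵀ)).PosSemidef := by
    rw [← Matrix.nonneg_iff_posSemidef]
    exact CFC.sqrt_nonneg _
  have hWW : CFC.sqrt (1 + A * Aᵀ) * CFC.sqrt (1 + A * Aᵀ) = 1 + A * Aᵀ :=
    CFC.sqrt_mul_sqrt_self _ (Matrix.nonneg_iff_posSemidef.2 h1.posSemidef)
  refine ⟨CFC.sqrt (1 + A * Aᵀ), by simpa using hW.isHermitian.eq, hWW, ?_, ?_⟩
  · have := h1.isUnit
    rw [← hWW] at this
    exact isUnit_of_mul_isUnit_left this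
  · exact (PosDef.posSemidef_add hW PosDef.one).isUnit

/-- The Gram matrix `1 + Aᵀ A` is normalized by a perturbation of the identity which factors
through `A`. -/
theorem exists_normalizer {ρ κ : Type} [Fintype ρ] [Fintype κ] [DecidableEq ρ] [DecidableEq κ]
    (A : Matrix ρ κ ℝ) :
    ∃ N : Matrix κ ρ ℝ, (1 + N * A)ᵀ * (1 + Aᵀ * A) * (1 + N * A) = 1 := by
  obtain ⟨W, hWt, hWW, hW, hW1⟩ := exists_sqrt_one_add A
  have hQ : A * Aᵀ = W * W - 1 := by rw [hWW]; abel
  obtain ⟨K, hK⟩ : ∃ K, K * (W * (W + 1)) = 1 := (hW.mul hW1).exists_left_inv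
  have hK' : (W * (W + 1)) * K = 1 := mul_eq_one_comm.1 hK
  have hKt : Kᵀ = K := by
    have h1 : (W * (W + 1)) * Kᵀ = 1 := by
      have := congrArg transpose hK
      rwa [transpose_mul, transpose_mul, transpose_add, hWt, transpose_one,
        show (W + 1) * W = W * (W + 1) by noncomm_ring] at this
    calc Kᵀ = (K * (W * (W + 1))) * Kᵀ := by rw [hK, one_mul]
      _ = K * ((W * (W + 1)) * Kᵀ) := by rw [Matrix.mul_assoc]
      _ = K := by rw [h1, mul_one]
  -- `1 - Aᵀ K A` is the inverse square root of `1 + Aᵀ A`: for an eigenvalue `λ` of `A Aᵀ` and `w =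
  -- √(1 + λ)`, it acts as `1 - λ / (w (w + 1)) = 1 / w`.
  refine ⟨-(Aᵀ * K), ?_⟩
  -- Expanding the product leaves `1` plus this expression between `Aᵀ` and `A`. It vanishes because
  -- `K` commutes with `W` and `K W² = 1 - K W`.
  have hbr : (1 : Matrix ρ ρ ℝ) - K - K * (A * Aᵀ) - K - (A * Aᵀ) * K
      + K * (A * Aᵀ) * K + K * (A * Aᵀ) * (A * Aᵀ) * K = 0 := by
    have hc : W * K = K * W := by
      calc W * K = (K * (W * (W + 1))) * (W * K) := by rw [hK, one_mul]
        _ = K * W * ((W * (W + 1)) * K) := by noncomm_ring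
        _ = K * W := by rw [hK', mul_one]
    have h2 : K * W * W = 1 - K * W := by
      rw [← hK]; noncomm_ring
    have h3 : W * W * K = 1 - K * W := by
      rw [Matrix.mul_assoc, hc, ← Matrix.mul_assoc, hc, h2]
    have h4 : K * (A * Aᵀ) * K + K * (A * Aᵀ) * (A * Aᵀ) * K = K * (W * W - 1) * (W * W * K) := by
      rw [hQ]; noncomm_ring
    have h5 : K * (W * W - 1) = 1 - K * W - K := by
      rw [mul_sub, ← Matrix.mul_assoc, h2, mul_one]
    have h6 : (1 - K * W - K) * (1 - K * W) = 1 - K * W - K * W := by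
      have h7 : K * (W * K * W) = K * (1 - K * W) := by
        rw [hc, h2]
      have : (1 - K * W - K) * (1 - K * W) =
        1 - K * W - K * W + K * (W * K * W) - K * (1 - K * W) := by noncomm_ring
      rw [this, h7]; abel
    rw [add_assoc, h4, h5, h3, h6, show (A * Aᵀ) * K = 1 - K * W - K by
      rw [hQ, sub_mul, h3, one_mul], show K * (A * Aᵀ) = 1 - K * W - K by rw [hQ, h5]]
    abel
  have : (1 + -(Aᵀ * K) * A)ᵀ * (1 + Aᵀ * A) * (1 + -(Aᵀ * K) * A) =
      1 + Aᵀ * (1 - K - K * (A * Aᵀ) - K - (A * Aᵀ) * K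
      + K * (A * Aᵀ) * K + K * (A * Aᵀ) * (A * Aᵀ) * K) * A := by
    rw [transpose_add, transpose_one, transpose_mul, transpose_neg, transpose_mul, hKt,
      transpose_transpose]
    simp only [Matrix.mul_add, Matrix.add_mul, Matrix.mul_sub, Matrix.sub_mul, Matrix.mul_neg,
      Matrix.neg_mul, Matrix.mul_one, Matrix.one_mul, ← Matrix.mul_assoc]
    abel
  rw [this, hbr, Matrix.mul_zero, Matrix.zero_mul, add_zero]

/-- Multiplication by the systematic code is cheap. -/
theorem computes_extensionMatrix {ι : Type} {m q : ℕ} (hqm : q ≤ m) (σ : Fin q → ι) :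
    Computes ((m - q) * (2 * q)) fun _ (x : ι → ℝ) =>
      extensionMatrix m q *ᵥ fun c => x (σ c) := by
  refine (Computes.entries (T := fun j : Fin m => if (j : ℕ) < q then 0 else 2 * q) fun j => ?_).mono ?_
  · split_ifs with hj
    · simp only [extensionMatrix_mulVec_of_lt _ j hj]
      exact ComputesReal.input _
    · exact (ComputesReal.dotConst (extensionMatrix m q j) σ).mono (by simp)
  · rw [← Fintype.sum_subtype_add_sum_subtype (fun j : Fin m => (j : ℕ) < q),
      Finset.sum_congr rfl fun (j : {j : Fin m // (j : ℕ) < q}) _ => if_pos j.2,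
      Finset.sum_congr rfl fun (j : ParityIndex m q) _ => if_neg j.2]
    rw [Finset.sum_const_zero, Finset.sum_const, Finset.card_univ, card_parityIndex hqm]
    simp

/-- There is an evaluation code with orthonormal columns and cheap encoding. -/
theorem exists_orthonormal_code {m q : ℕ} (hq : 0 < q) (hqm : q ≤ m) :
    ∃ B : Matrix (Fin m) (Fin q) ℝ, IsEvalCode B ∧ Bᵀ * B = 1 ∧
      Computes (6 * q * (m - q) + q) fun _ (x : Fin q → ℝ) => B *ᵥ x := by
  obtain ⟨N, hN⟩ := exists_normalizer (parityMatrix m q)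
  have hBB : (extensionMatrix m q * (1 + N * parityMatrix m q))ᵀ *
      (extensionMatrix m q * (1 + N * parityMatrix m q)) = 1 := by
    rw [transpose_mul, Matrix.mul_assoc, ← Matrix.mul_assoc (extensionMatrix m q)ᵀ,
      transpose_mul_extensionMatrix hqm, ← Matrix.mul_assoc, hN]
  refine ⟨extensionMatrix m q * (1 + N * parityMatrix m q), ⟨fun u hu => ?_, fun u => ?_⟩, hBB, ?_⟩
  · rw [← one_mulVec u, ← hBB, ← mulVec_mulVec, hu, mulVec_zero]
  · obtain ⟨f, hf, h⟩ := (isEvalCode_extensionMatrix hq hqm).exists_poly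
      ((1 + N * parityMatrix m q) *ᵥ u)
    exact ⟨f, hf, fun j => by rw [← mulVec_mulVec, h]⟩
  · have h1 : Computes ((m - q) * (2 * q)) fun _ (x : Fin q → ℝ) => parityMatrix m q *ᵥ x := by
      refine (Computes.entries (T := fun _ => 2 * q) fun j =>
        (ComputesReal.dotConst (parityMatrix m q j) id).mono (by simp)).mono ?_
      rw [Finset.sum_const, Finset.card_univ, card_parityIndex hqm, smul_eq_mul]
    have h2 : Computes (q * (2 * (m - q) + 1))
        fun _ (x : Fin q ⊕ ParityIndex m q → ℝ) =>
          (fun c => x (Sum.inl c)) + N *ᵥ fun j => x (Sum.inr j) := by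
      refine (Computes.entries (T := fun _ => 2 * (m - q) + 1) fun c =>
        ((ComputesReal.input (Sum.inl c)).add
          (ComputesReal.dotConst (N c) Sum.inr)).mono ?_).mono ?_
      · rw [card_parityIndex hqm]; omega
      · simp
    -- The product is never multiplied out: parity rows, then the correction `x + N (A x)`, then
    -- systematic encoding cost about `2 q (m - q)` each.
    have h := (computes_extensionMatrix hqm id).comp (h2.comp h1.keep)
    refine Computes.mono (S := (m - q) * (2 * q) + q * (2 * (m - q) + 1) + (m - q) * (2 * q))
      ?_ (by ring_nf; omega)
    convert h using 3
    rename_i x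
    simp only [id, Sum.elim_inl, Sum.elim_inr]
    rw [← mulVec_mulVec, add_mulVec, one_mulVec, ← mulVec_mulVec]

/-! ### Coordinate descent for generalized linear models -/

theorem lineDeriv_glmObjective {n : ℕ} {κ : Type} [Fintype κ] [DecidableEq κ] {ℓ : ℝ → ℝ → ℝ}
    (hℓ : ∀ b, Differentiable ℝ fun x => ℓ x b) (X : Matrix (Fin n) κ ℝ) (y : Fin n → ℝ)
    (w : κ → ℝ) (j : κ) :
    lineDeriv ℝ (glmObjective ℓ X y) w (Pi.single j 1) =
      ∑ i, X i j * scalarDeriv ℓ ((X *ᵥ w) i) (y i) := by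
  refine HasLineDerivAt.lineDeriv ?_
  have hX : ∀ (t : ℝ) (i : Fin n),
      (X *ᵥ (w + t • Pi.single j (1 : ℝ))) i = (X *ᵥ w) i + t * X i j := by
    intro t i
    rw [mulVec_add, mulVec_smul, mulVec_single_one]
    rfl
  unfold HasLineDerivAt glmObjective
  simp only [hX]
  refine HasDerivAt.fun_sum fun i _ => ?_
  have h1 : HasDerivAt (fun t : ℝ => (X *ᵥ w) i + t * X i j) (X i j) 0 := by
    simpa using ((hasDerivAt_id (0 : ℝ)).mul_const (X i j)).const_add ((X *ᵥ w) i)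
  have h2 : HasDerivAt (fun x => ℓ x (y i)) (scalarDeriv ℓ ((X *ᵥ w) i) (y i))
      ((X *ᵥ w) i + 0 * X i j) := by
    rw [zero_mul, add_zero]
    exact ((hℓ (y i)) _).hasDerivAt
  rw [mul_comm]
  exact h2.comp (0 : ℝ) h1

/-! ### Chunks of coordinates -/

theorem div_lt_numBlocks {N q j : ℕ} (hq : 0 < q) (hj : j < N) : j / q < numBlocks N q := by
  rw [numBlocks, Nat.div_lt_iff_lt_mul hq]
  have := Nat.div_add_mod' (N + q - 1) q
  have := Nat.mod_lt (N + q - 1) hq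
  omega

theorem numBlocks_mul_lt {N q : ℕ} (hq : 0 < q) : numBlocks N q * q < N + q := by
  have := Nat.div_mul_le_self (N + q - 1) q
  unfold numBlocks
  omega

theorem numBlocks_eq_of_dvd {N q : ℕ} (hq : 0 < q) (h : q ∣ N) : numBlocks N q * q = N := by
  obtain ⟨k, rfl⟩ := h
  rw [numBlocks, Nat.add_sub_assoc (by omega), Nat.mul_add_div hq,
    Nat.div_eq_of_lt (by omega : q - 1 < q), add_zero, mul_comm]

/-- The chunk to which a coordinate belongs. -/
def chunkIndex {N q : ℕ} (hq : 0 < q) (j : Fin N) : Fin (numBlocks N q) :=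
  ⟨j / q, div_lt_numBlocks hq j.2⟩

/-- The position of a coordinate in its chunk. -/
def chunkOffset {N q : ℕ} (hq : 0 < q) (j : Fin N) : Fin q :=
  ⟨j % q, Nat.mod_lt _ hq⟩

theorem chunk_ext {N q : ℕ} (hq : 0 < q) {j j' : Fin N} (h : chunkIndex hq j = chunkIndex hq j')
    (h' : chunkOffset hq j = chunkOffset hq j') : j = j' := by
  have h1 : (j : ℕ) / q = j' / q := congrArg Fin.val h
  have h2 : (j : ℕ) % q = j' % q := congrArg Fin.val h'
  refine Fin.ext ?_
  rw [← Nat.div_add_mod (j : ℕ) q, ← Nat.div_add_mod (j' : ℕ) q, h1, h2]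

theorem mem_chunkCoords {N q : ℕ} (hq : 0 < q) (U : Finset (Fin (numBlocks N q))) (j : Fin N) :
    j ∈ chunkCoords U ↔ chunkIndex hq j ∈ U := by
  simp only [chunkCoords, Finset.mem_filter, Finset.mem_univ, true_and]
  constructor
  · rintro ⟨a, ha, h1, h2⟩
    convert ha
    exact Fin.ext (Nat.div_eq_of_lt_le h1 h2)
  · intro h
    exact ⟨_, h, Nat.div_mul_le_self _ _, by
      show (j : ℕ) < ((j : ℕ) / q + 1) * q
      have := Nat.div_add_mod' (j : ℕ) q
      have := Nat.mod_lt (j : ℕ) hq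
      rw [add_mul]
      omega⟩

theorem chunkCoords_univ {N q : ℕ} (hq : 0 < q) :
    chunkCoords (Finset.univ : Finset (Fin (numBlocks N q))) = (Finset.univ : Finset (Fin N)) := by
  ext j
  simp [mem_chunkCoords hq]

theorem card_chunkCoords {N q : ℕ} (hq : 0 < q) (U : Finset (Fin (numBlocks N q))) :
    (chunkCoords (N := N) U).card =
      ∑ a ∈ U, (Finset.univ.filter fun j : Fin N => chunkIndex hq j = a).card := by
  rw [Finset.card_eq_sum_card_fiberwise (f := chunkIndex hq) (t := U)
    fun j hj => (mem_chunkCoords hq U j).1 hj]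
  refine Finset.sum_congr rfl fun a ha => ?_
  congr 1
  ext j
  simp only [Finset.mem_filter, Finset.mem_univ, true_and, mem_chunkCoords hq]
  exact ⟨fun h => h.2, fun h => ⟨h ▸ ha, h⟩⟩

theorem card_chunk_le {N q : ℕ} (hq : 0 < q) (a : Fin (numBlocks N q)) :
    (Finset.univ.filter fun j : Fin N => chunkIndex hq j = a).card ≤ q := by
  refine (Finset.card_le_card_of_injOn (chunkOffset hq) (t := Finset.univ)
    (fun _ _ => Finset.mem_coe.2 (Finset.mem_univ _)) fun j hj j' hj' h => ?_).trans (by simp)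
  simp only [Finset.coe_filter, Finset.mem_univ, true_and, Set.mem_ofPred_eq] at hj hj'
  exact chunk_ext hq (hj.trans hj'.symm) h

theorem card_chunk_of_le {N q : ℕ} (hq : 0 < q) (a : Fin (numBlocks N q))
    (ha : ((a : ℕ) + 1) * q ≤ N) :
    (Finset.univ.filter fun j : Fin N => chunkIndex hq j = a).card = q := by
  refine le_antisymm (card_chunk_le hq a) ?_
  have hlt : ∀ c : Fin q, (a : ℕ) * q + c < N := fun c => by
    have := c.2
    rw [add_mul] at ha
    omega
  have := Finset.card_le_card_of_injOn (s := (Finset.univ : Finset (Fin q)))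
    (t := Finset.univ.filter fun j : Fin N => chunkIndex hq j = a)
    (fun c => ⟨(a : ℕ) * q + c, hlt c⟩)
    (fun c _ => by
      simp only [Finset.coe_filter, Finset.mem_univ, true_and, Set.mem_ofPred_eq]
      refine Fin.ext ?_
      simp only [chunkIndex]
      rw [mul_comm, Nat.mul_add_div hq, Nat.div_eq_of_lt c.2, add_zero])
    (fun c _ c' _ h => Fin.ext (by simpa using h))
  simpa using this

theorem card_chunkCoords_le {N q : ℕ} (hq : 0 < q) (U : Finset (Fin (numBlocks N q))) :
    (chunkCoords (N := N) U).card ≤ U.card * q := by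
  rw [card_chunkCoords hq, ← smul_eq_mul]
  exact Finset.sum_le_card_nsmul _ _ _ fun a _ => card_chunk_le hq a

/-- Counting the complement: the chunks outside `U` cover at most `q` coordinates each, and all
chunks together would overshoot `N` by less than `q`. -/
theorem lt_card_chunkCoords {N q : ℕ} (hq : 0 < q) (U : Finset (Fin (numBlocks N q))) :
    U.card * q < (chunkCoords (N := N) U).card + q := by
  have h1 := card_chunkCoords hq U
  have h2 := card_chunkCoords_le (N := N) hq Uᶜ
  have h3 := card_chunkCoords hq Uᶜ
  have h4 := card_chunkCoords (N := N) hq Finset.univ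
  rw [← Finset.sum_add_sum_compl U, ← h1, ← h3, chunkCoords_univ hq, Finset.card_univ,
    Fintype.card_fin] at h4
  have h5 := Finset.card_add_card_compl U
  rw [Fintype.card_fin] at h5
  have h6 := numBlocks_mul_lt (N := N) hq
  rw [← h5, add_mul] at h6
  omega

theorem card_chunkCoords_eq {N q : ℕ} (hq : 0 < q) (U : Finset (Fin (numBlocks N q)))
    (hU : ∀ a ∈ U, ((a : ℕ) + 1) * q ≤ N) : (chunkCoords (N := N) U).card = U.card * q := by
  rw [card_chunkCoords hq, Finset.sum_congr rfl fun a ha => card_chunk_of_le hq a (hU a ha),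
    Finset.sum_const, smul_eq_mul]

/-- The chunk with index `a` of a vector, padded by zeros. -/
def chunk {N q : ℕ} (w : Fin N → ℝ) (a : Fin (numBlocks N q)) (c : Fin q) : ℝ :=
  if h : (a : ℕ) * q + c < N then w ⟨(a : ℕ) * q + c, h⟩ else 0

theorem chunk_index_offset {N q : ℕ} (hq : 0 < q) (w : Fin N → ℝ) (j : Fin N) :
    chunk w (chunkIndex hq j) (chunkOffset hq j) = w j := by
  have h : (j : ℕ) / q * q + j % q = j := Nat.div_add_mod' _ _
  simp only [chunk, chunkIndex, chunkOffset, h, j.2, dif_pos]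

/-- Reading a chunk is free. -/
theorem computes_chunk {ι : Type} {N q : ℕ} (σ : Fin N → ι) (a : Fin (numBlocks N q)) :
    Computes 0 fun _ (x : ι → ℝ) => chunk (q := q) (fun j => x (σ j)) a := by
  have h := Computes.read (ι := ι) fun c : Fin q =>
    if h : (a : ℕ) * q + c < N then Sum.inl (σ ⟨(a : ℕ) * q + c, h⟩) else Sum.inr 0
  convert h using 4
  rename_i c
  unfold chunk
  split_ifs <;> rfl

/-! ### Block-structured encoding -/

theorem blockEncoding_apply {m q N : ℕ} (hq : 0 < q) (B : Matrix (Fin m) (Fin q) ℝ) (i : Fin m)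
    (a : Fin (numBlocks N q)) (j : Fin N) :
    blockEncoding N B (i, a) j = if chunkIndex hq j = a then B i (chunkOffset hq j) else 0 := by
  have hiff : ((a : ℕ) * q ≤ (j : ℕ) ∧ (j : ℕ) - (a : ℕ) * q < q) ↔ chunkIndex hq j = a := by
    rw [Fin.ext_iff]
    show _ ↔ (j : ℕ) / q = a
    constructor
    · rintro ⟨h1, h2⟩
      exact Nat.div_eq_of_lt_le h1 (by rw [add_mul]; omega)
    · rintro h
      have := Nat.div_add_mod' (j : ℕ) q
      have := Nat.mod_lt (j : ℕ) hq
      rw [h] at *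
      omega
  unfold blockEncoding
  by_cases h : chunkIndex hq j = a
  · rw [dif_pos (hiff.2 h), if_pos h]
    congr 1
    refine Fin.ext ?_
    show (j : ℕ) - a * q = j % q
    rw [← h]
    have := Nat.div_add_mod' (j : ℕ) q
    simp only [chunkIndex]
    omega
  · rw [dif_neg fun h' => h (hiff.1 h'), if_neg h]

theorem chunk_eq_sum {N q : ℕ} (hq : 0 < q) (w : Fin N → ℝ) (a : Fin (numBlocks N q))
    (c : Fin q) :
    chunk w a c = ∑ j, if chunkIndex hq j = a ∧ chunkOffset hq j = c then w j else 0 := by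
  unfold chunk
  split_ifs with h
  · have hj : chunkIndex hq (⟨(a : ℕ) * q + c, h⟩ : Fin N) = a ∧
        chunkOffset hq (⟨(a : ℕ) * q + c, h⟩ : Fin N) = c := by
      constructor <;> refine Fin.ext ?_
      · show ((a : ℕ) * q + c) / q = a
        rw [mul_comm, Nat.mul_add_div hq, Nat.div_eq_of_lt c.2, add_zero]
      · show ((a : ℕ) * q + c) % q = c
        rw [mul_comm, Nat.mul_add_mod, Nat.mod_eq_of_lt c.2]
    rw [Finset.sum_eq_single_of_mem _ (Finset.mem_univ (⟨(a : ℕ) * q + c, h⟩ : Fin N)), if_pos hj]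
    intro j _ hne
    rw [if_neg]
    rintro ⟨h1, h2⟩
    exact hne (chunk_ext hq (h1.trans hj.1.symm) (h2.trans hj.2.symm))
  · refine (Finset.sum_eq_zero fun j _ => if_neg ?_).symm
    rintro ⟨h1, h2⟩
    apply h
    rw [← h1, ← h2]
    show (j : ℕ) / q * q + j % q < N
    rw [Nat.div_add_mod']
    exact j.2

/-- Every chunk is encoded separately by the matrix `B`. -/
theorem blockEncoding_mulVec {m q N : ℕ} (hq : 0 < q) (B : Matrix (Fin m) (Fin q) ℝ)
    (w : Fin N → ℝ) (i : Fin m) (a : Fin (numBlocks N q)) :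
    (blockEncoding N B *ᵥ w) (i, a) = (B *ᵥ chunk w a) i := by
  simp only [mulVec, dotProduct, blockEncoding_apply hq, chunk_eq_sum hq w a, Finset.mul_sum]
  rw [Finset.sum_comm]
  refine Finset.sum_congr rfl fun j _ => ?_
  rw [Finset.sum_eq_single_of_mem (chunkOffset hq j) (Finset.mem_univ _)]
  · by_cases h : chunkIndex hq j = a <;> simp [h]
  · intro c _ hc
    rw [if_neg fun h => hc h.2.symm, mul_zero]

/-- Columns from different chunks have disjoint supports; within one chunk they are columns of `B`,
and a truncated last chunk merely uses fewer of them. -/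
theorem transpose_blockEncoding_mul {m q N : ℕ} (hq : 0 < q) {B : Matrix (Fin m) (Fin q) ℝ}
    (hB : Bᵀ * B = 1) : (blockEncoding N B)ᵀ * blockEncoding N B = 1 := by
  ext j j'
  rw [mul_apply, Fintype.sum_prod_type]
  simp only [transpose_apply, blockEncoding_apply hq]
  have h : ∀ i : Fin m, (∑ a : Fin (numBlocks N q),
      (if chunkIndex hq j = a then B i (chunkOffset hq j) else 0) *
        (if chunkIndex hq j' = a then B i (chunkOffset hq j') else 0)) =
      if chunkIndex hq j = chunkIndex hq j' then
        B i (chunkOffset hq j) * B i (chunkOffset hq j') else 0 := by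
    intro i
    rw [Finset.sum_eq_single_of_mem (chunkIndex hq j) (Finset.mem_univ _)]
    · rw [if_pos rfl]
      split_ifs with h1 h2 h2
      · rfl
      · exact absurd h1.symm h2
      · exact absurd h2.symm h1
      · rw [mul_zero]
    · intro a _ ha
      rw [if_neg fun h => ha h.symm, zero_mul]
  rw [Finset.sum_congr rfl fun i _ => h i]
  by_cases hj : j = j'
  · subst hj
    have := congrFun (congrFun hB (chunkOffset hq j)) (chunkOffset hq j)
    rw [mul_apply, one_apply_eq] at this
    simpa using this
  · rw [one_apply_ne hj]
    split_ifs with h1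
    · have := congrFun (congrFun hB (chunkOffset hq j)) (chunkOffset hq j')
      rw [mul_apply, one_apply_ne fun h2 => hj (chunk_ext hq h1 h2)] at this
      exact this
    · exact Finset.sum_const_zero

/-! ### Programs of the scheme -/

/-- The specification of the programs of a scheme: linear encoding, and decoding by `decode` with
the matrices `DL` and `DR`. -/
structure CDScheme.Implements {m n d q : ℕ} (P : CDScheme m n d q) (hq : 0 < q)
    (DL DR : Finset (Fin m) → Matrix (Fin q) (Fin m) ℝ) : Prop where
  encode : ∀ dl (x : Fin n × Fin d → ℝ), P.encode.eval dl x = fun p =>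
    Sum.elim (fun aj : Fin (numBlocks n q) × Fin d =>
        (P.BL *ᵥ chunk (fun k => x (k, aj.2)) aj.1) p.1)
      (fun ka : Fin n × Fin (numBlocks d q) =>
        (P.BR *ᵥ chunk (fun j => x (ka.1, j)) ka.2) p.1) p.2
  worker₁ : ∀ i U' dl x, (P.worker₁ i U').eval dl x = fun a =>
    ∑ j : Broadcast₁ U', x (Sum.inl (Sum.inl (Sum.inl (a, j.1)))) * x (Sum.inr j)
  worker₂ : ∀ i U dl x, (P.worker₂ i U).eval dl x = fun a =>
    x (Sum.inl (Sum.inr a.1)) - x (Sum.inr (Sum.inr ())) *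
      ∑ k : Fin n, x (Sum.inl (Sum.inl (Sum.inr (k, a.1)))) * x (Sum.inr (Sum.inl k))
  master₁ : ∀ dl (w : Fin d → ℝ) u y z, P.master₁.eval dl (Sum.elim (masterMemory w u y) z) =
    let u' : Fin n → ℝ := fun k =>
      u k - decode DL (fun i => z (i, chunkIndex hq k)) (chunkOffset hq k)
    Sum.elim u' fun k => dl (u' k) (y k)
  master₂ : ∀ U dl w (u y : Fin n → ℝ) z,
    (P.master₂ U).eval dl (Sum.elim (masterMemory w u y) z) =
    let w' : ↥(chunkCoords (N := d) U) → ℝ := fun j =>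
      decode DR (fun i => z (i, ⟨chunkIndex hq j.1, (mem_chunkCoords hq U j.1).1 j.2⟩))
        (chunkOffset hq j.1)
    Sum.elim w' fun j => w j.1 - w' j

section Programs

variable {m n d q : ℕ}

theorem computes_encode (hqm : q ≤ m) {B : Matrix (Fin m) (Fin q) ℝ} {T : ℕ}
    (hB : Computes T fun _ (x : Fin q → ℝ) => B *ᵥ x) :
    Computes (numBlocks n q * d * ((m - q) * (2 * q)) + n * numBlocks d q * T)
      fun _ (x : Fin n × Fin d → ℝ) (p : Fin m × EncodedData n d q) =>
        Sum.elim (fun aj : Fin (numBlocks n q) × Fin d =>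
            (extensionMatrix m q *ᵥ chunk (fun k => x (k, aj.2)) aj.1) p.1)
          (fun ka : Fin n × Fin (numBlocks d q) =>
            (B *ᵥ chunk (fun j => x (ka.1, j)) ka.2) p.1) p.2 := by
  have h1 := Computes.pi fun aj : Fin (numBlocks n q) × Fin d =>
    (computes_extensionMatrix hqm id).comp
      (computes_chunk (fun k : Fin n => ((k, aj.2) : Fin n × Fin d)) aj.1)
  have h2 := Computes.pi fun ka : Fin n × Fin (numBlocks d q) =>
    hB.comp (computes_chunk (fun j : Fin d => ((ka.1, j) : Fin n × Fin d)) ka.2)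
  have h := ((h1.pair h2).relabel_comp fun p : Fin m × EncodedData n d q =>
    Sum.elim (fun aj => Sum.inl (aj, p.1)) (fun ka => Sum.inr (ka, p.1)) p.2).mono
      (T := numBlocks n q * d * ((m - q) * (2 * q)) + n * numBlocks d q * T) (by simp)
  convert h using 4
  rename_i p
  obtain ⟨i, e | e⟩ := p <;> rfl

theorem computes_worker₁ (U' : Finset (Fin (numBlocks d q))) :
    Computes (numBlocks n q * (2 * (chunkCoords (N := d) U').card))
      fun _ (x : WorkerMemory n d q ⊕ Broadcast₁ U' → ℝ) (a : Answer₁ n q) =>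
        ∑ j : Broadcast₁ U', x (Sum.inl (Sum.inl (Sum.inl (a, j.1)))) * x (Sum.inr j) := by
  refine (Computes.entries (T := fun _ => 2 * (chunkCoords (N := d) U').card) fun a =>
    (ComputesReal.sum Finset.univ fun j _ =>
      (ComputesReal.input _).mul (ComputesReal.input _)).mono ?_).mono ?_
  · rw [Finset.card_univ, Fintype.card_coe]; omega
  · simp

theorem computes_worker₂ (U : Finset (Fin (numBlocks d q))) :
    Computes (U.card * (2 * n + 2))
      fun _ (x : WorkerMemory n d q ⊕ (Broadcast₂ n ⊕ Unit) → ℝ) (a : Answer₂ U) =>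
        x (Sum.inl (Sum.inr a.1)) - x (Sum.inr (Sum.inr ())) *
          ∑ k : Fin n, x (Sum.inl (Sum.inl (Sum.inr (k, a.1)))) * x (Sum.inr (Sum.inl k)) := by
  refine (Computes.entries (T := fun _ => 2 * n + 2) fun a =>
    ((ComputesReal.input _).sub ((ComputesReal.input _).mul
      (ComputesReal.sum Finset.univ fun j _ =>
        (ComputesReal.input _).mul (ComputesReal.input _)))).mono ?_).mono ?_
  · rw [Finset.card_univ, Fintype.card_fin]; omega
  · simp

/-- Each chunk is decoded once and its result is shared by all coordinates in it, so the quadratic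
cost is paid per chunk. -/
theorem computes_master₁ (hq : 0 < q) (hqm : q ≤ m)
    (D : Finset (Fin m) → Matrix (Fin q) (Fin m) ℝ) :
    Computes (numBlocks n q * (12 * m ^ 2) + 2 * n)
      fun dl (x : MasterMemory n d ⊕ (Fin m × Answer₁ n q) → ℝ) =>
        let u' : Fin n → ℝ := fun k => x (Sum.inl (Sum.inr (Sum.inl k))) -
          decode D (fun i => x (Sum.inr (i, chunkIndex hq k))) (chunkOffset hq k)
        Sum.elim u' fun k => dl (u' k) (x (Sum.inl (Sum.inr (Sum.inr k)))) := by
  have h1 := Computes.pi fun a : Fin (numBlocks n q) => (computes_decode hqm D).comp_relabel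
    fun i => (Sum.inr (i, a) : MasterMemory n d ⊕ (Fin m × Answer₁ n q))
  have h2 : Computes n fun _ (x : (MasterMemory n d ⊕ (Fin m × Answer₁ n q)) ⊕
      (Fin (numBlocks n q) × Fin q) → ℝ) (k : Fin n) =>
      x (Sum.inl (Sum.inl (Sum.inr (Sum.inl k)))) - x (Sum.inr (chunkIndex hq k, chunkOffset hq k)) :=
    (Computes.entries (T := fun _ => 1) fun k =>
      (ComputesReal.input _).sub (ComputesReal.input _)).mono (by simp)
  have h3 : Computes n fun dl (x : (MasterMemory n d ⊕ (Fin m × Answer₁ n q)) ⊕ Fin n → ℝ)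
      (k : Fin n) => dl (x (Sum.inr k)) (x (Sum.inl (Sum.inl (Sum.inr (Sum.inr k))))) :=
    (Computes.entries (T := fun _ => 1) fun k =>
      (ComputesReal.input _).lossDeriv (ComputesReal.input _)).mono (by simp)
  have h := ((h3.keep.comp (h2.comp h1.keep).keep).relabel_comp
    (Sum.elim (fun k => Sum.inl (Sum.inr k)) Sum.inr :
      Fin n ⊕ Fin n → ((MasterMemory n d ⊕ (Fin m × Answer₁ n q)) ⊕ Fin n) ⊕ Fin n)).mono
      (T := numBlocks n q * (12 * m ^ 2) + 2 * n) (by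
        rw [Finset.sum_const, Finset.card_univ, Fintype.card_fin, smul_eq_mul]; omega)
  convert h using 4
  rename_i k
  cases k <;> rfl

theorem computes_master₂ (hq : 0 < q) (hqm : q ≤ m)
    (D : Finset (Fin m) → Matrix (Fin q) (Fin m) ℝ) (U : Finset (Fin (numBlocks d q))) :
    Computes (U.card * (12 * m ^ 2) + (chunkCoords (N := d) U).card)
      fun _ (x : MasterMemory n d ⊕ (Fin m × Answer₂ U) → ℝ) =>
        let w' : ↥(chunkCoords (N := d) U) → ℝ := fun j =>
          decode D (fun i => x (Sum.inr
            (i, ⟨chunkIndex hq j.1, (mem_chunkCoords hq U j.1).1 j.2⟩))) (chunkOffset hq j.1)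
        Sum.elim w' fun j : Broadcast₁ U => x (Sum.inl (Sum.inl j.1)) - w' j := by
  have h1 := (Computes.pi fun a : ↥U => (computes_decode hqm D).comp_relabel
    fun i => (Sum.inr (i, a) : MasterMemory n d ⊕ (Fin m × Answer₂ U))).relabel_comp
      fun j : ↥(chunkCoords (N := d) U) =>
        (((⟨chunkIndex hq j.1, (mem_chunkCoords hq U j.1).1 j.2⟩ : ↥U), chunkOffset hq j.1))
  have h2 : Computes (chunkCoords (N := d) U).card
      fun _ (x : (MasterMemory n d ⊕ (Fin m × Answer₂ U)) ⊕ ↥(chunkCoords (N := d) U) → ℝ)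
        (j : Broadcast₁ U) => x (Sum.inl (Sum.inl (Sum.inl j.1))) - x (Sum.inr j) :=
    (Computes.entries (T := fun _ => 1) fun k =>
      (ComputesReal.input _).sub (ComputesReal.input _)).mono (by simp)
  have h := ((h2.keep.comp h1.keep).relabel_comp
    (Sum.elim (fun k => Sum.inl (Sum.inr k)) Sum.inr :
      ↥(chunkCoords (N := d) U) ⊕ Broadcast₁ U → _)).mono
      (T := U.card * (12 * m ^ 2) + (chunkCoords (N := d) U).card) (by
        rw [Finset.sum_const, Finset.card_univ, Fintype.card_coe, smul_eq_mul])
  convert h using 4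
  rename_i k
  cases k <;> rfl

end Programs

/-- There is a scheme with the required programs, within explicit time bounds. -/
theorem exists_implements {m q : ℕ} (n d : ℕ) (hq : 0 < q) (hqm : q ≤ m) :
    ∃ (P : CDScheme m n d q) (DL DR : Finset (Fin m) → Matrix (Fin q) (Fin m) ℝ),
      P.Implements hq DL DR ∧ IsEvalCode P.BL ∧ IsEvalCode P.BR ∧ P.BRᵀ * P.BR = 1 ∧
      (∀ J, q ≤ J.card → ∀ u y, (∀ j ∈ J, y j = (P.BL *ᵥ u) j) → DL J *ᵥ y = u) ∧
      (∀ J, q ≤ J.card → ∀ u y, (∀ j ∈ J, y j = (P.BR *ᵥ u) j) → DR J *ᵥ y = u) ∧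
      P.encode.time ≤ numBlocks n q * d * ((m - q) * (2 * q)) +
        n * numBlocks d q * (6 * q * (m - q) + q) ∧
      (∀ i U, (P.worker₁ i U).time ≤ numBlocks n q * (2 * (chunkCoords (N := d) U).card)) ∧
      (∀ i U, (P.worker₂ i U).time ≤ U.card * (2 * n + 2)) ∧
      P.master₁.time ≤ numBlocks n q * (12 * m ^ 2) + 2 * n ∧
      ∀ U, (P.master₂ U).time ≤ U.card * (12 * m ^ 2) + (chunkCoords (N := d) U).card := by
  obtain ⟨B, hB, hBB, hBT⟩ := exists_orthonormal_code hq hqm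
  have hG := isEvalCode_extensionMatrix hq hqm
  obtain ⟨DL, hDL⟩ := hG.exists_recover
  obtain ⟨DR, hDR⟩ := hB.exists_recover
  obtain ⟨PE, hPEt, hPE⟩ := computes_encode (n := n) (d := d) hqm hBT
  choose W₁ hW₁t hW₁ using computes_worker₁ (n := n) (d := d) (q := q)
  choose W₂ hW₂t hW₂ using computes_worker₂ (n := n) (d := d) (q := q)
  obtain ⟨M₁, hM₁t, hM₁⟩ := computes_master₁ (n := n) (d := d) hq hqm DL
  choose M₂ hM₂t hM₂ using computes_master₂ (n := n) (d := d) hq hqm DR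
  exact ⟨⟨extensionMatrix m q, B, PE, fun _ => W₁, M₁, fun _ => W₂, M₂⟩, DL, DR,
    ⟨hPE, fun _ => hW₁, fun _ => hW₂, fun dl w u y z => hM₁ dl _,
      fun U dl w u y z => hM₂ U dl _⟩, hG, hB, hBB, hDL, hDR, hPEt, fun _ => hW₁t, fun _ => hW₂t,
      hM₁t, hM₂t⟩

/-! ### Resilience -/

-- Wrong entries come only from stragglers, which are read as zero, and from corrupt workers. Both
-- kinds count as errors at unknown positions.
open Classical in
theorem Delivered.card_errors_le {m : ℕ} {κ : Type} {s t r : ℕ} {sent : Fin m → κ → ℝ}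
    {recv : Fin m → Option (κ → ℝ)} (h : Delivered s t sent recv) (hr : s + t ≤ r) (k : κ) :
    (Finset.univ.filter fun i => readAnswers recv (i, k) ≠ sent i k).card ≤ r := by
  obtain ⟨A, B, hA, hB, -, h⟩ := h
  refine (Finset.card_le_card fun i hi => ?_).trans
    ((Finset.card_union_le A B).trans ((add_le_add hA hB).trans hr))
  rw [Finset.mem_filter] at hi
  by_contra hAB
  rw [Finset.mem_union, not_or] at hAB
  exact hi.2 (by simp [readAnswers, h i hAB.1 hAB.2])

theorem Delivered.decode_eq {m q r s t : ℕ} {κ : Type} (hq : 0 < q) (hm : m = q + 2 * r)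
    (hr : s + t ≤ r) {B : Matrix (Fin m) (Fin q) ℝ} (hB : IsEvalCode B)
    {D : Finset (Fin m) → Matrix (Fin q) (Fin m) ℝ}
    (hD : ∀ J, q ≤ J.card → ∀ u y, (∀ j ∈ J, y j = (B *ᵥ u) j) → D J *ᵥ y = u)
    {sent : Fin m → κ → ℝ} {recv : Fin m → Option (κ → ℝ)} (h : Delivered s t sent recv)
    (k : κ) {u : Fin q → ℝ} (hu : ∀ i, sent i k = (B *ᵥ u) i) :
    decode D (fun i => readAnswers recv (i, k)) = u := by
  refine _root_.decode_eq hq hm hB hD ?_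
  have := h.card_errors_le hr k
  simpa only [hu] using this

namespace CDScheme

variable {m n d q : ℕ} {P : CDScheme m n d q}

theorem transpose_S_mul_S (hq : 0 < q) (hB : P.BRᵀ * P.BR = 1) : P.Sᵀ * P.S = 1 :=
  transpose_blockEncoding_mul hq hB

theorem rightPinv_R (hq : 0 < q) (hB : P.BRᵀ * P.BR = 1) : rightPinv P.R = P.S := by
  rw [rightPinv, R, transpose_transpose, transpose_S_mul_S hq hB, inv_one, Matrix.mul_one]

theorem encodedData_eq (hq : 0 < q) (X : Matrix (Fin n) (Fin d) ℝ) (i : Fin m)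
    (e : EncodedData n d q) :
    P.encodedData X i e =
      Sum.elim (fun aj : Fin (numBlocks n q) × Fin d =>
          (P.BL *ᵥ chunk (fun k => X k aj.2) aj.1) i)
        (fun ka : Fin n × Fin (numBlocks d q) =>
          (P.BR *ᵥ chunk (fun j => X ka.1 j) ka.2) i) e := by
  rcases e with ⟨a, j⟩ | ⟨k, a⟩
  · exact blockEncoding_mulVec hq P.BL (fun k => X k j) i a
  · rw [Sum.elim_inr, ← blockEncoding_mulVec hq P.BR]
    show (X * P.R) k (i, a) = (P.S *ᵥ fun j => X k j) (i, a)
    rw [mul_apply]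
    exact Finset.sum_congr rfl fun j _ => mul_comm (X k j) (P.S (i, a) j)

/-- The value that the workers have been told before iteration `k`. -/
def toldValue (w : ℕ → Fin d → ℝ) : ℕ → Fin d → ℝ
  | 0 => 0
  | k + 1 => w k

/-- What holds at the start of iteration `k`. -/
structure Synchronized {dl : ℝ → ℝ → ℝ} {X : Matrix (Fin n) (Fin d) ℝ} {y : Fin n → ℝ}
    {α : ℕ → ℝ} {U : ℕ → Finset (Fin (numBlocks d q))} {w0 : Fin d → ℝ} {s t : ℕ}
    (E : CDExecution P dl X y α U w0 s t) (k : ℕ) : Prop where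
  v_eq : E.v k = P.S *ᵥ E.w k
  u_eq : E.u k = X *ᵥ toldValue E.w k
  δ_eq : ∀ j, E.δ k j = toldValue E.w k j - E.w k j
  unchanged : ∀ j, j ∉ chunkCoords (N := d) (previousChoice U k) → toldValue E.w k j = E.w k j

section Execution

variable {DL DR : Finset (Fin m) → Matrix (Fin q) (Fin m) ℝ} {r s t : ℕ} {dl : ℝ → ℝ → ℝ}
  {X : Matrix (Fin n) (Fin d) ℝ} {y : Fin n → ℝ} {α : ℕ → ℝ}
  {U : ℕ → Finset (Fin (numBlocks d q))} {w0 : Fin d → ℝ} {E : CDExecution P dl X y α U w0 s t}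
  {k : ℕ}

theorem synchronized_zero (hq : 0 < q) (hB : P.BRᵀ * P.BR = 1) : Synchronized E 0 where
  v_eq := by rw [E.v_zero, E.w_zero, rightPinv_R hq hB]
  u_eq := by rw [E.u_zero]; exact (mulVec_zero X).symm
  δ_eq j := by rw [E.δ_zero, E.w_zero]; simp [toldValue]
  unchanged j hj := by
    -- Before the first iteration all chunks count as chosen, so no coordinate lies outside.
    refine absurd ?_ hj
    show j ∈ chunkCoords Finset.univ
    rw [chunkCoords_univ hq]
    exact Finset.mem_univ j

/-- The honest first answer encodes `X` times the change of the parameter. -/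
theorem worker₁_answer {hq : 0 < q} (hP : P.Implements hq DL DR) (hk : Synchronized E k)
    (i : Fin m) (a : Fin (numBlocks n q)) :
    (P.worker₁ i (previousChoice U k)).eval dl (Sum.elim (P.workerMemory X (E.v k) i) (E.δ k)) a =
      (P.BL *ᵥ chunk (X *ᵥ (toldValue E.w k - E.w k)) a) i := by
  rw [hP.worker₁, ← blockEncoding_mulVec hq]
  show ∑ j : ↥(chunkCoords (previousChoice U k)), (P.L * X) (i, a) j * E.δ k j =
    (P.L *ᵥ (X *ᵥ (toldValue E.w k - E.w k))) (i, a)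
  rw [mulVec_mulVec]
  simp only [hk.δ_eq]
  rw [Finset.sum_coe_sort (chunkCoords (previousChoice U k))
    fun j => (P.L * X) (i, a) j * (toldValue E.w k j - E.w k j)]
  -- Outside the broadcast coordinates the parameter has not changed, so the short sum equals the
  -- full product.
  refine Finset.sum_subset (Finset.subset_univ _) fun j _ hj => ?_
  rw [hk.unchanged j hj, sub_self, mul_zero]

/-- Decoding yields `X (w_old - w)`; subtracting it from the stored `X w_old` leaves `X w`, to which
the scalar derivative is applied. -/
theorem master₁_result {hq : 0 < q} (hm : m = q + 2 * r) (hr : s + t ≤ r)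
    (hP : P.Implements hq DL DR) (hBL : IsEvalCode P.BL)
    (hDL : ∀ J, q ≤ J.card → ∀ u y, (∀ j ∈ J, y j = (P.BL *ᵥ u) j) → DL J *ᵥ y = u)
    (hk : Synchronized E k) :
    E.u (k + 1) = X *ᵥ E.w k ∧ ∀ i, E.g k i = dl ((X *ᵥ E.w k) i) (y i) := by
  have hdec : ∀ a, decode DL (fun i => readAnswers (E.recv₁ k) (i, a)) =
      chunk (X *ᵥ (toldValue E.w k - E.w k)) a := fun a =>
    (E.round₁ k).decode_eq hq hm hr hBL hDL a fun i => worker₁_answer hP hk i a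
  have h := E.master₁ k
  rw [hP.master₁] at h
  have hu : ∀ i, E.u (k + 1) i = (X *ᵥ E.w k) i := by
    intro i
    have hi := congrFun h (Sum.inl i)
    simp only [Sum.elim_inl, hdec, chunk_index_offset] at hi
    rw [hi, hk.u_eq, mulVec_sub, Pi.sub_apply, sub_sub_cancel]
  refine ⟨funext hu, fun i => ?_⟩
  have hi := congrFun h (Sum.inr i)
  have hi' := congrFun h (Sum.inl i)
  simp only [Sum.elim_inl, Sum.elim_inr] at hi hi'
  rw [hi, ← hi', hu]

/-- One step of coordinate descent along a given gradient. -/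
def descend {κ : Type} [DecidableEq κ] (α : ℝ) (F : Finset κ) (G w : κ → ℝ) : κ → ℝ :=
  fun j => if j ∈ F then w j - α * G j else w j

/-- Row `(i, a)` of `S` is supported on chunk `a`, all of which is updated if `a ∈ U` and none of
which is updated otherwise. -/
theorem S_mulVec_descend (hq : 0 < q) (α : ℝ) (U : Finset (Fin (numBlocks d q)))
    (G w : Fin d → ℝ) (i : Fin m) (a : Fin (numBlocks d q)) :
    (P.S *ᵥ descend α (chunkCoords U) G w) (i, a) =
      if a ∈ U then (P.S *ᵥ w) (i, a) - α * (P.S *ᵥ G) (i, a) else (P.S *ᵥ w) (i, a) := by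
  have h : ∀ j, P.S (i, a) j * descend α (chunkCoords U) G w j =
      P.S (i, a) j * w j - (if a ∈ U then α else 0) * (P.S (i, a) j * G j) := by
    intro j
    have hS : P.S (i, a) j = _ := blockEncoding_apply hq P.BR i a j
    rw [hS, descend]
    simp only [mem_chunkCoords hq]
    by_cases hj : chunkIndex hq j = a
    · subst hj
      split_ifs <;> ring
    · rw [if_neg hj]
      ring
  simp only [mulVec, dotProduct, h, Finset.sum_sub_distrib, ← Finset.mul_sum]
  split_ifs <;> simp

/-- The local updates of the workers add up to an encoding of the updated `w`, since the columns of
`X R` turn `g` into `S (Xᵀ g)`. No property of `g` is needed here. -/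
theorem v_succ {hq : 0 < q} (hP : P.Implements hq DL DR) (hk : Synchronized E k) :
    E.v (k + 1) = P.S *ᵥ descend (α k) (chunkCoords (U k)) (E.g k ᵥ* X) (E.w k) := by
  funext ⟨i, a⟩
  rw [S_mulVec_descend hq, ← hk.v_eq]
  split_ifs with ha
  · rw [E.v_update k i ⟨a, ha⟩, hP.worker₂]
    show E.v k (i, a) - α k * ∑ l, (X * P.R) l (i, a) * E.g k l = _
    rw [← vecMul_transpose, vecMul_vecMul]
    congr 2
    exact Finset.sum_congr rfl fun _ _ => mul_comm _ _
  · exact E.v_keep k i a ha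

/-- By `v_succ` the honest answers at `a ∈ U k` form a codeword whose message is chunk `a` of the
new parameter, so decoding returns that chunk itself. -/
theorem master₂_result {hq : 0 < q} (hm : m = q + 2 * r) (hr : s + t ≤ r)
    (hP : P.Implements hq DL DR) (hBR : IsEvalCode P.BR)
    (hDR : ∀ J, q ≤ J.card → ∀ u y, (∀ j ∈ J, y j = (P.BR *ᵥ u) j) → DR J *ᵥ y = u)
    (hk : Synchronized E k) :
    E.w (k + 1) = descend (α k) (chunkCoords (U k)) (E.g k ᵥ* X) (E.w k) ∧
      ∀ j, E.δ (k + 1) j = E.w k j - E.w (k + 1) j := by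
  have hdec : ∀ a : ↥(U k), decode DR (fun i => readAnswers (E.recv₂ k) (i, a)) =
      chunk (descend (α k) (chunkCoords (U k)) (E.g k ᵥ* X) (E.w k)) a.1 := fun a =>
    (E.round₂ k).decode_eq hq hm hr hBR hDR a fun i => by
      rw [v_succ hP hk, ← blockEncoding_mulVec hq]
      rfl
  have h := E.master₂ k
  rw [hP.master₂] at h
  refine ⟨funext fun j => ?_, fun (j : Broadcast₁ (U k)) => ?_⟩
  · by_cases hj : j ∈ chunkCoords (U k)
    · have hi := congrFun h (Sum.inl ⟨j, hj⟩)
      simp only [Sum.elim_inl, hdec, chunk_index_offset] at hi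
      exact hi
    · rw [E.w_keep k j hj, descend, if_neg hj]
  · have hi := congrFun h (Sum.inr j)
    have hi' := congrFun h (Sum.inl j)
    exact hi.trans (congrArg (E.w k j - ·) hi'.symm)

theorem synchronized {hq : 0 < q} (hm : m = q + 2 * r) (hr : s + t ≤ r)
    (hP : P.Implements hq DL DR) (hBL : IsEvalCode P.BL) (hBR : IsEvalCode P.BR)
    (hB : P.BRᵀ * P.BR = 1)
    (hDL : ∀ J, q ≤ J.card → ∀ u y, (∀ j ∈ J, y j = (P.BL *ᵥ u) j) → DL J *ᵥ y = u)
    (hDR : ∀ J, q ≤ J.card → ∀ u y, (∀ j ∈ J, y j = (P.BR *ᵥ u) j) → DR J *ᵥ y = u) :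
    Synchronized E k := by
  induction k with
  | zero => exact synchronized_zero hq hB
  | succ k hk =>
    obtain ⟨h1, h2⟩ := master₂_result hm hr hP hBR hDR hk
    exact ⟨by rw [v_succ hP hk, h1], (master₁_result hm hr hP hBL hDL hk).1, h2,
      fun j hj => (E.w_keep k j hj).symm⟩

end Execution

theorem cdStep_eq_descend {κ : Type} [Fintype κ] [DecidableEq κ] {ℓ : ℝ → ℝ → ℝ}
    (hℓ : ∀ b, Differentiable ℝ fun x => ℓ x b) (X : Matrix (Fin n) κ ℝ) (y g : Fin n → ℝ)
    (α : ℝ) (F : Finset κ) (w : κ → ℝ) (hg : ∀ i, g i = scalarDeriv ℓ ((X *ᵥ w) i) (y i)) :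
    cdStep ℓ X y α F w = descend α F (g ᵥ* X) w := by
  funext j
  unfold cdStep descend
  rw [lineDeriv_glmObjective hℓ]
  simp only [← hg]
  congr 3
  exact Finset.sum_congr rfl fun _ _ => mul_comm _ _

theorem S_mulVec_descend_eq (hq : 0 < q) (X : Matrix (Fin n) (Fin d) ℝ) (g : Fin n → ℝ) (α : ℝ)
    (U : Finset (Fin (numBlocks d q))) (w : Fin d → ℝ) :
    P.S *ᵥ descend α (chunkCoords U) (g ᵥ* X) w =
      descend α (Finset.univ ×ˢ U) (g ᵥ* (X * P.R)) (P.S *ᵥ w) := by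
  funext ⟨i, a⟩
  rw [S_mulVec_descend hq, descend, ← vecMul_vecMul, R, vecMul_transpose]
  simp

/-- Below the threshold, the scheme carries out plain coordinate descent. -/
theorem resilience {DL DR : Finset (Fin m) → Matrix (Fin q) (Fin m) ℝ} {hq : 0 < q} {r s t : ℕ}
    (hm : m = q + 2 * r) (hr : s + t ≤ r)
    (hP : P.Implements hq DL DR) (hBL : IsEvalCode P.BL) (hBR : IsEvalCode P.BR)
    (hB : P.BRᵀ * P.BR = 1)
    (hDL : ∀ J, q ≤ J.card → ∀ u y, (∀ j ∈ J, y j = (P.BL *ᵥ u) j) → DL J *ᵥ y = u)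
    (hDR : ∀ J, q ≤ J.card → ∀ u y, (∀ j ∈ J, y j = (P.BR *ᵥ u) j) → DR J *ᵥ y = u)
    {ℓ : ℝ → ℝ → ℝ} (hℓ : ∀ b, Differentiable ℝ fun x => ℓ x b)
    {X : Matrix (Fin n) (Fin d) ℝ} {y : Fin n → ℝ} {α : ℕ → ℝ}
    {U : ℕ → Finset (Fin (numBlocks d q))} {w0 : Fin d → ℝ}
    (E : CDExecution P (scalarDeriv ℓ) X y α U w0 s t) (k : ℕ) :
    E.w (k + 1) = cdStep ℓ X y (α k) (chunkCoords (U k)) (E.w k) ∧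
      E.v (k + 1) = cdStep ℓ (X * P.R) y (α k) (Finset.univ ×ˢ U k) (E.v k) ∧
      E.v k = rightPinv P.R *ᵥ E.w k ∧
      E.u (k + 1) = X *ᵥ E.w k ∧
      (∀ i, E.g k i = scalarDeriv ℓ ((X *ᵥ E.w k) i) (y i)) ∧
      ∀ j, E.δ k j = (if k = 0 then 0 else E.w (k - 1) j) - E.w k j := by
  have hk : Synchronized E k := synchronized hm hr hP hBL hBR hB hDL hDR
  obtain ⟨hu, hg⟩ := master₁_result hm hr hP hBL hDL hk
  obtain ⟨hw, -⟩ := master₂_result hm hr hP hBR hDR hk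
  -- The two objectives are evaluated at the same point of `ℝⁿ`, so the one broadcast vector serves
  -- both descents.
  have hXv : (X * P.R) *ᵥ E.v k = X *ᵥ E.w k := by
    rw [hk.v_eq, mulVec_mulVec, Matrix.mul_assoc, R, transpose_S_mul_S hq hB, Matrix.mul_one]
  refine ⟨?_, ?_, ?_, hu, hg, fun j => ?_⟩
  · rw [hw, cdStep_eq_descend hℓ X y (E.g k) _ _ _ hg]
  · rw [v_succ hP hk, cdStep_eq_descend hℓ (X * P.R) y (E.g k) _ _ _ (by rwa [hXv]), hk.v_eq,
      S_mulVec_descend_eq hq]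
  · rw [hk.v_eq, rightPinv_R hq hB]
  · rw [hk.δ_eq]
    cases k <;> rfl

end CDScheme

/-! ### Block size and cost estimates -/

theorem two_mul_cdThreshold_le (m : ℕ) {ε : ℝ} (hε : 0 < ε) :
    2 * (cdThreshold m ε : ℝ) ≤ ε / (1 + ε) * m := by
  have : (cdThreshold m ε : ℝ) ≤ ε / (1 + ε) * ((m : ℝ) / 2) :=
    Nat.floor_le (by positivity)
  linarith

theorem eq_blockSize_add (m : ℕ) {ε : ℝ} (hε : 0 < ε) :
    m = blockSize m ε + 2 * cdThreshold m ε := by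
  have h := two_mul_cdThreshold_le m hε
  have h1 : ε / (1 + ε) * m ≤ m :=
    mul_le_of_le_one_left (Nat.cast_nonneg m) ((div_le_one (by linarith)).2 (by linarith))
  have h2 : 2 * cdThreshold m ε ≤ m := by exact_mod_cast h.trans h1
  unfold blockSize
  omega

theorem div_le_blockSize (m : ℕ) {ε : ℝ} (hε : 0 < ε) : (m : ℝ) / (1 + ε) ≤ blockSize m ε := by
  have h := two_mul_cdThreshold_le m hε
  have h1 : (m : ℝ) = blockSize m ε + 2 * cdThreshold m ε := by
    exact_mod_cast eq_blockSize_add m hε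
  have h2 : (m : ℝ) / (1 + ε) = m - ε / (1 + ε) * m := by field_simp; ring
  linarith

theorem blockSize_lt (m : ℕ) {ε : ℝ} (hε : 0 < ε) : (blockSize m ε : ℝ) < m / (1 + ε) + 2 := by
  have h : ε / (1 + ε) * ((m : ℝ) / 2) < cdThreshold m ε + 1 := Nat.lt_floor_add_one _
  have h1 : (m : ℝ) = blockSize m ε + 2 * cdThreshold m ε := by
    exact_mod_cast eq_blockSize_add m hε
  have h2 : (m : ℝ) / (1 + ε) = m - ε / (1 + ε) * m := by field_simp; ring
  linarith

theorem blockSize_pos {m : ℕ} (hm : 0 < m) {ε : ℝ} (hε : 0 < ε) : 0 < blockSize m ε := by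
  have h : (0 : ℝ) < m / (1 + ε) := by positivity
  exact_mod_cast h.trans_le (div_le_blockSize m hε)

theorem numBlocks_mul_le {N q : ℕ} (hq : 0 < q) (hqN : q ≤ N) : numBlocks N q * q ≤ 2 * N := by
  have := numBlocks_mul_lt (N := N) hq
  omega

theorem mul_numBlocks_le {m N q : ℕ} {ε : ℝ} (hq : 0 < q) (hmq : (m : ℝ) ≤ (1 + ε) * q) :
    (m : ℝ) * numBlocks N q ≤ (1 + ε) * N + m := by
  have h1 : (numBlocks N q : ℝ) * q ≤ N + q := by exact_mod_cast (numBlocks_mul_lt hq).le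
  have hq' : (0 : ℝ) < q := by exact_mod_cast hq
  have h2 : (m : ℝ) * (numBlocks N q * q) ≤ m * (N + q) :=
    mul_le_mul_of_nonneg_left h1 (Nat.cast_nonneg m)
  have h3 : (m : ℝ) * N ≤ (1 + ε) * q * N := mul_le_mul_of_nonneg_right hmq (Nat.cast_nonneg N)
  refine le_of_mul_le_mul_right ?_ hq'
  linarith

theorem mul_numBlocks_le_two_mul {m N q : ℕ} {ε : ℝ} (hε : 0 < ε) (hq : 0 < q) (hqN : q ≤ N)
    (hmq : (m : ℝ) ≤ (1 + ε) * q) : (m : ℝ) * numBlocks N q ≤ 2 * ((1 + ε) * N) := by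
  have h1 : (numBlocks N q : ℝ) * q ≤ 2 * N := by exact_mod_cast numBlocks_mul_le hq hqN
  calc (m : ℝ) * numBlocks N q ≤ (1 + ε) * q * numBlocks N q :=
        mul_le_mul_of_nonneg_right hmq (Nat.cast_nonneg _)
    _ = (1 + ε) * (numBlocks N q * q) := by ring
    _ ≤ (1 + ε) * (2 * N) := mul_le_mul_of_nonneg_left h1 (by linarith)
    _ = 2 * ((1 + ε) * N) := by ring

theorem mul_numBlocks_of_dvd {m N q : ℕ} {ε : ℝ} (hq : 0 < q) (h : q ∣ N)
    (hmq : (q : ℝ) * (1 + ε) = m) : (m : ℝ) * numBlocks N q = (1 + ε) * N := by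
  have : (numBlocks N q : ℝ) * q = N := by exact_mod_cast numBlocks_eq_of_dvd hq h
  rw [← hmq, ← this]
  ring

theorem totalStorage_eq (m n d q : ℕ) : (totalStorage m n d q : ℝ) =
    m * numBlocks n q * d + m * numBlocks d q * n + m * numBlocks d q := by
  simp only [totalStorage, WorkerMemory, EncodedData, Fintype.card_prod, Fintype.card_sum,
    Fintype.card_fin]
  push_cast
  ring

theorem realsSentByWorker_eq (n : ℕ) {d q : ℕ} (U : Finset (Fin (numBlocks d q))) :
    realsSentByWorker n U = U.card + numBlocks n q := by
  simp only [realsSentByWorker, Fintype.card_fin, Fintype.card_coe]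
  ring

theorem realsBroadcast_eq (n : ℕ) {d q : ℕ} (U : Finset (Fin (numBlocks d q))) :
    realsBroadcast n U = (chunkCoords (N := d) U).card + n := by
  simp only [realsBroadcast, Fintype.card_fin, Fintype.card_coe]

/-- Since `q ≥ m / (1 + ε)`, that many blocks of length `q` suffice to cover `n`, and `numBlocks` is
the least such number. -/
theorem numBlocks_le_ceil {m n q : ℕ} {ε : ℝ} (hm : 0 < m) (hq : 0 < q)
    (hmq : (m : ℝ) ≤ (1 + ε) * q) (hε : 0 < ε) : numBlocks n q ≤ ⌈(1 + ε) * n / m⌉₊ := by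
  have h1 : (1 + ε) * n / m ≤ (⌈(1 + ε) * n / m⌉₊ : ℝ) := Nat.le_ceil _
  have hm' : (0 : ℝ) < m := by exact_mod_cast hm
  rw [div_le_iff₀ hm'] at h1
  have h2 : (⌈(1 + ε) * n / m⌉₊ : ℝ) * m ≤ ⌈(1 + ε) * n / m⌉₊ * ((1 + ε) * q) :=
    mul_le_mul_of_nonneg_left hmq (Nat.cast_nonneg _)
  have h3 : (n : ℝ) ≤ ⌈(1 + ε) * n / m⌉₊ * q := by
    refine le_of_mul_le_mul_left ?_ (by linarith : 0 < 1 + ε)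
    linarith
  have h4 : n ≤ ⌈(1 + ε) * n / m⌉₊ * q := by exact_mod_cast h3
  have h5 := numBlocks_mul_lt (N := n) hq
  have h6 : numBlocks n q * q < (⌈(1 + ε) * n / m⌉₊ + 1) * q := by
    rw [add_mul]; omega
  exact Nat.lt_succ_iff.1 (lt_of_mul_lt_mul_right h6 (Nat.zero_le q))

/-- As `q` is at most `n` and `d`, rounding up to whole chunks at most doubles the lengths; the
factor `m - q = 2r` becomes `ε / (1 + ε) * m`. -/
theorem encode_time_le {m n d q r T : ℕ} {ε : ℝ} (hq : 0 < q) (hqn : q ≤ n) (hqd : q ≤ d)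
    (hm : m = q + 2 * r) (hr : 2 * (r : ℝ) ≤ ε / (1 + ε) * m)
    (hT : T ≤ numBlocks n q * d * ((m - q) * (2 * q)) +
      n * numBlocks d q * (6 * q * (m - q) + q)) :
    (T : ℝ) ≤ 32 * (n * d * (ε / (1 + ε) * m + 1)) := by
  have h1 := numBlocks_mul_le hq hqn
  have h2 := numBlocks_mul_le hq hqd
  have h3 : T ≤ 32 * (n * d * (2 * r + 1)) := by
    refine hT.trans ?_
    rw [show m - q = 2 * r by omega]
    calc _ = (numBlocks n q * q) * (4 * r * d) + (numBlocks d q * q) * (n * (12 * r + 1)) := by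
          ring
      _ ≤ (2 * n) * (4 * r * d) + (2 * d) * (n * (12 * r + 1)) := by gcongr
      _ ≤ 32 * (n * d * (2 * r + 1)) := by
          rw [show 32 * (n * d * (2 * r + 1)) = (2 * n) * (4 * r * d) + (2 * d) * (n * (12 * r + 1))
            + (32 * (n * d * r) + 30 * (n * d)) by ring]
          exact Nat.le_add_right _ _
  calc (T : ℝ) ≤ 32 * (n * d * (2 * r + 1)) := by exact_mod_cast h3
    _ ≤ _ := by gcongr

theorem worker_time_le {n q τ F T₁ T₂ : ℕ} (hq : 0 < q) (hqn : q ≤ n) (hF : F ≤ τ * q)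
    (h₁ : T₁ ≤ numBlocks n q * (2 * F)) (h₂ : T₂ ≤ τ * (2 * n + 2)) :
    (T₁ + T₂ : ℝ) ≤ 32 * (n * τ) := by
  have h : T₁ + T₂ ≤ 32 * (n * τ) := by
    calc T₁ + T₂ ≤ numBlocks n q * (2 * (τ * q)) + τ * (2 * n + 2 * n) := by
          refine add_le_add (h₁.trans (by gcongr)) (h₂.trans ?_)
          gcongr
          omega
      _ = (numBlocks n q * q) * (2 * τ) + τ * (4 * n) := by ring
      _ ≤ (2 * n) * (2 * τ) + τ * (4 * n) :=
          Nat.add_le_add_right (Nat.mul_le_mul_right _ (numBlocks_mul_le hq hqn)) _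
      _ ≤ 32 * (n * τ) := by nlinarith [Nat.zero_le (n * τ)]
  exact_mod_cast h

theorem first_worker_time_le {m n d q τ T₁ T₂ : ℕ} {ε : ℝ} (hm : 0 < m) (hq : 0 < q) (hqn : q ≤ n)
    (hε : 0 < ε) (hmq : (m : ℝ) ≤ (1 + ε) * q)
    (h₁ : T₁ ≤ numBlocks n q * (2 * d)) (h₂ : T₂ ≤ τ * (2 * n + 2)) :
    (T₁ + T₂ : ℝ) ≤ 32 * (n * τ + (1 + ε) * (n * d / m)) := by
  have hm' : (0 : ℝ) < m := by exact_mod_cast hm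
  have h1 : (T₁ : ℝ) ≤ numBlocks n q * (2 * d) := by exact_mod_cast h₁
  have h2 : (T₂ : ℝ) ≤ 4 * (n * τ) := by
    have : T₂ ≤ 4 * (n * τ) := h₂.trans (by
      calc τ * (2 * n + 2) ≤ τ * (4 * n) := by gcongr; omega
        _ = 4 * (n * τ) := by ring)
    exact_mod_cast this
  have h3 : (numBlocks n q : ℝ) ≤ 2 * ((1 + ε) * n) / m := by
    rw [le_div_iff₀ hm', mul_comm]
    exact mul_numBlocks_le_two_mul hε hq hqn hmq
  have h4 : (numBlocks n q : ℝ) * (2 * d) ≤ 2 * ((1 + ε) * n) / m * (2 * d) := by gcongr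
  have h5 : 2 * ((1 + ε) * n) / m * (2 * d) = 4 * ((1 + ε) * (n * d / m)) := by ring
  have h6 : 0 ≤ (1 + ε) * ((n : ℝ) * d / m) := by positivity
  have h7 : (0 : ℝ) ≤ n * τ := by positivity
  linarith

theorem master_time_le {m n q τ F T₁ T₂ : ℕ} {ε : ℝ} (hm : 0 < m) (hq : 0 < q) (hqm : q ≤ m)
    (hqn : q ≤ n) (hε : 0 < ε) (hmq : (m : ℝ) ≤ (1 + ε) * q) (hF : F ≤ τ * q)
    (h₁ : T₁ ≤ numBlocks n q * (12 * m ^ 2) + 2 * n) (h₂ : T₂ ≤ τ * (12 * m ^ 2) + F) :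
    (T₁ + T₂ : ℝ) ≤ 32 * ((1 + ε) * (n * m) + τ * (m : ℝ) ^ 2) := by
  have hm' : (1 : ℝ) ≤ m := by exact_mod_cast hm
  have h1 : (T₁ : ℝ) ≤ (m * numBlocks n q) * (12 * m) + 2 * n := by
    have : (T₁ : ℝ) ≤ numBlocks n q * (12 * m ^ 2) + 2 * n := by exact_mod_cast h₁
    linarith
  have h2 : (m * numBlocks n q : ℝ) * (12 * m) ≤ 2 * ((1 + ε) * n) * (12 * m) :=
    mul_le_mul_of_nonneg_right (mul_numBlocks_le_two_mul hε hq hqn hmq) (by positivity)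
  have h3 : (n : ℝ) ≤ (1 + ε) * (n * m) := by
    have h31 : (n : ℝ) ≤ n * m := le_mul_of_one_le_right (Nat.cast_nonneg n) hm'
    exact h31.trans (le_mul_of_one_le_left (by positivity) (by linarith))
  have h4 : (T₂ : ℝ) ≤ 13 * (τ * (m : ℝ) ^ 2) := by
    have : T₂ ≤ 13 * (τ * m ^ 2) := by
      have hF' : F ≤ τ * m ^ 2 := hF.trans (by
        gcongr
        exact hqm.trans (Nat.le_self_pow two_ne_zero m))
      linarith
    exact_mod_cast this
  have h5 : (0 : ℝ) ≤ τ * (m : ℝ) ^ 2 := by positivity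
  have h6 : (0 : ℝ) ≤ (1 + ε) * (n * m) := by positivity
  linarith

/-! ### Assembly of the theorem -/

theorem theorem2 :
    ∃ C : ℝ, 0 < C ∧
    ∀ (m n d : ℕ) (ε : ℝ), 0 < m → m ≤ n → m ≤ d → 0 < ε →
    ∃ P : CDScheme m n d (blockSize m ε),
      -- the encoding: `S` has orthonormal columns, it is the Moore-Penrose inverse of `R = Sᵀ`, and
      -- the encoding program computes all `L_i X` and `X R_i`
      P.BRᵀ * P.BR = 1 ∧ P.Sᵀ * P.S = 1 ∧ P.R * rightPinv P.R = 1 ∧ rightPinv P.R = P.S ∧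
      (∀ (dl : ℝ → ℝ → ℝ) (X : Matrix (Fin n) (Fin d) ℝ) (i : Fin m) (e : EncodedData n d _),
        P.encode.eval dl (fun kj => X kj.1 kj.2) (i, e) = P.encodedData X i e) ∧
      -- resilience: in every execution with `s` stragglers and `t` corrupt workers below the
      -- threshold, `w` evolves as in plain coordinate descent, and `v = R⁺ w` throughout
      (∀ s t : ℕ, s + t ≤ cdThreshold m ε →
        ∀ (ℓ : ℝ → ℝ → ℝ), (∀ b, Differentiable ℝ fun x => ℓ x b) →
        ∀ (X : Matrix (Fin n) (Fin d) ℝ) (y : Fin n → ℝ) (α : ℕ → ℝ)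
          (U : ℕ → Finset (Fin (numBlocks d (blockSize m ε)))) (w0 : Fin d → ℝ)
          (E : CDExecution P (scalarDeriv ℓ) X y α U w0 s t) (k : ℕ),
          E.w (k + 1) = cdStep ℓ X y (α k) (chunkCoords (U k)) (E.w k) ∧
          E.v (k + 1) = cdStep ℓ (X * P.R) y (α k) (Finset.univ ×ˢ U k) (E.v k) ∧
          E.v k = rightPinv P.R *ᵥ E.w k ∧
          E.u (k + 1) = X *ᵥ E.w k ∧
          (∀ i, E.g k i = scalarDeriv ℓ ((X *ᵥ E.w k) i) (y i)) ∧
          (∀ j, E.δ k j = (if k = 0 then 0 else E.w (k - 1) j) - E.w k j)) ∧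
      -- the block size is `m/(1+ε)` up to rounding
      (m : ℝ) / (1 + ε) ≤ blockSize m ε ∧ (blockSize m ε : ℝ) < m / (1 + ε) + 2 ∧
      -- storage
      (totalStorage m n d (blockSize m ε) : ℝ)
        ≤ 2 * (1 + ε) * (n * d) + (1 + ε) * d + m * (n + d + 1) ∧
      ((blockSize m ε : ℝ) * (1 + ε) = m → blockSize m ε ∣ n → blockSize m ε ∣ d →
        (totalStorage m n d (blockSize m ε) : ℝ) = 2 * (1 + ε) * (n * d) + (1 + ε) * d) ∧
      -- encoding time
      (P.encode.time : ℝ) ≤ C * (n * d * (ε / (1 + ε) * m + 1)) ∧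
      -- an iteration that updates the coordinates in `U` of every `v_i`, `τ = |U|`
      (∀ (τ : ℕ) (U : Finset (Fin (numBlocks d (blockSize m ε)))), U.card = τ →
        -- the number of updated coordinates of `w`
        (chunkCoords (N := d) U).card ≤ τ * blockSize m ε ∧
        τ * blockSize m ε < (chunkCoords (N := d) U).card + blockSize m ε ∧
        ((∀ a ∈ U, ((a : ℕ) + 1) * blockSize m ε ≤ d) →
          (chunkCoords (N := d) U).card = τ * blockSize m ε ∧
          ((blockSize m ε : ℝ) * (1 + ε) = m →
            ((chunkCoords (N := d) U).card : ℝ) = τ * m / (1 + ε))) ∧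
        -- communication of a worker
        (realsSentByWorker n U : ℝ) ≤ τ + (⌈(1 + ε) * n / m⌉₊ : ℝ) ∧
        ((blockSize m ε : ℝ) * (1 + ε) = m → blockSize m ε ∣ n →
          (realsSentByWorker n U : ℝ) = τ + (1 + ε) * n / m) ∧
        -- communication and computation, if the previous iteration used `U'`, also of size `τ`
        (∀ U' : Finset (Fin (numBlocks d (blockSize m ε))), U'.card = τ →
          realsBroadcast n U' = (chunkCoords (N := d) U').card + n ∧
          (realsBroadcast n U' : ℝ) ≤ τ * (m / (1 + ε) + 2) + n ∧
          ((blockSize m ε : ℝ) * (1 + ε) = m →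
            (realsBroadcast n U' : ℝ) ≤ τ * m / (1 + ε) + n) ∧
          (∀ i, ((P.worker₁ i U').time + (P.worker₂ i U).time : ℝ) ≤ C * (n * τ))) ∧
        -- in the very first iteration the whole of `w` is new to the workers
        (∀ i, ((P.worker₁ i Finset.univ).time + (P.worker₂ i U).time : ℝ)
          ≤ C * (n * τ + (1 + ε) * (n * d / m))) ∧
        -- computation of the master
        (P.master₁.time + (P.master₂ U).time : ℝ) ≤ C * ((1 + ε) * (n * m) + τ * (m : ℝ) ^ 2)) := by
  -- A common constant with room to spare: the largest requirement, `26`, comes from the master,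
  -- with `24` for decoding and `2` for updating `X w` and applying the loss derivative.
  refine ⟨32, by norm_num, fun m n d ε hm hmn hmd hε => ?_⟩
  have hq := blockSize_pos hm hε
  have hmqr := eq_blockSize_add m hε
  have hr := two_mul_cdThreshold_le m hε
  have hdiv := div_le_blockSize m hε
  have hlt := blockSize_lt m hε
  have hε1 : 0 < 1 + ε := by linarith
  have hm0 : (m : ℝ) ≠ 0 := by positivity
  set q := blockSize m ε with hqdef
  have hqm : q ≤ m := by omega
  have hqn := hqm.trans hmn
  have hmq : (m : ℝ) ≤ (1 + ε) * q := by rwa [div_le_iff₀ hε1, mul_comm] at hdiv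
  obtain ⟨P, DL, DR, hP, hBL, hBR, hB, hDL, hDR, hTE, hT₁, hT₂, hTM₁, hTM₂⟩ :=
    exists_implements n d hq hqm
  refine ⟨P, hB, P.transpose_S_mul_S hq hB, ?_, P.rightPinv_R hq hB, ?_, ?_, hdiv, hlt, ?_, ?_,
    encode_time_le hq hqn (hqm.trans hmd) hmqr hr hTE, ?_⟩
  · rw [P.rightPinv_R hq hB]
    exact P.transpose_S_mul_S hq hB
  · intro dl X i e
    rw [hP.encode, P.encodedData_eq hq]
  · intro s t hst ℓ hℓ X y α U w0 E k
    exact CDScheme.resilience hmqr hst hP hBL hBR hB hDL hDR hℓ E k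
  · rw [totalStorage_eq]
    have h1 := mul_le_mul_of_nonneg_right (mul_numBlocks_le (N := n) hq hmq)
      (Nat.cast_nonneg (α := ℝ) d)
    have h2 := mul_numBlocks_le (N := d) hq hmq
    have h3 := mul_le_mul_of_nonneg_right h2 (Nat.cast_nonneg (α := ℝ) n)
    linarith
  · intro hex hn hd
    rw [totalStorage_eq, mul_numBlocks_of_dvd hq hn hex, mul_numBlocks_of_dvd hq hd hex]
    ring
  · rintro τ U rfl
    have hexdiv : (q : ℝ) * (1 + ε) = m → (q : ℝ) = m / (1 + ε) := fun h =>
      (eq_div_iff hε1.ne').2 h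
    refine ⟨card_chunkCoords_le hq U, lt_card_chunkCoords hq U, fun hU => ?_, ?_, ?_, ?_, ?_, ?_⟩
    · have h := card_chunkCoords_eq hq U hU
      refine ⟨h, fun hex => ?_⟩
      rw [h, Nat.cast_mul, hexdiv hex, mul_div_assoc]
    · rw [realsSentByWorker_eq, Nat.cast_add]
      gcongr
      exact numBlocks_le_ceil hm hq hmq hε
    · intro hex hn
      rw [realsSentByWorker_eq, Nat.cast_add, ← mul_numBlocks_of_dvd hq hn hex,
        mul_div_cancel_left₀ _ hm0]
    · intro U' hU'
      have hF := card_chunkCoords_le (N := d) hq U'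
      rw [hU'] at hF
      have hF' : ((chunkCoords (N := d) U').card : ℝ) ≤ U.card * q := by exact_mod_cast hF
      refine ⟨realsBroadcast_eq n U', ?_, fun hex => ?_, fun i =>
        worker_time_le hq hqn hF (hT₁ i U') (hT₂ i U)⟩
      · rw [realsBroadcast_eq, Nat.cast_add]
        have := mul_le_mul_of_nonneg_left hlt.le (Nat.cast_nonneg (α := ℝ) U.card)
        linarith
      · rw [realsBroadcast_eq, Nat.cast_add, mul_div_assoc, ← hexdiv hex]
        linarith
    · intro i
      have h := hT₁ i Finset.univ
      rw [chunkCoords_univ hq, Finset.card_univ, Fintype.card_fin] at h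
      exact first_worker_time_le hm hq hqn hε hmq h (hT₂ i U)
    · exact master_time_le hm hq hqm hqn hε hmq (card_chunkCoords_le hq U) hTM₁ (hTM₂ U)
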